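/- **Setting.** Let $\mathcal G$ be a finite connected graph with at least two nodes and diameter $D=D(\mathcal G)\ge 1$; let $d\ge 1$ and $b\ge 0$ be integers, $G\ge 0$ a real number, and $k=\lfloor b/D\rfloor$. In every round $t=1,2,\dots,T$ the active node $I_t$ of $\mathcal G$ makes a prediction $w_t\in\mathbb R^d$, the adversary picks a convex $G$-Lipschitz loss $\ell_t:\mathbb R^d\to\mathbb R$ (Euclidean norm), and $I_t$ is given a subgradient $g_t\in\partial\ell_t(w_t)$. The joint regret is $\mathcal R_T(u)=\sum_{t=1}^T(\ell_t(w_t)-\ell_t(u))$. Encoded gradients are forwarded along one edge per round, so that in round $t$ a node $n$ holds those of the rounds $s<t$ with $\mathrm{dist}_{\mathcal G}(I_s,n)\le t-s$. A *gradient-oblivious algorithm with a deterministic encoding with $k$ bits per gradient* consists, for each horizon $T$ (which is known to the nodes in advance), of an arbitrary encoder $C:\{g\in\mathbb R^d:\|g\|\le G\}\to\{0,1\}^k$, an arbitrary decoder $F:\{0,1\}^k\to\mathbb R^d$, and arbitrary deterministic rules by which the active node computes $w_t$ from its identity, from $t$, and from the pairs $(s,\hat g_s)$, $\hat g_s=F(C(g_s))$,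 of the gradients that it holds (but not from the true gradients). **Theorem (Lower Bound I: Deterministic Encoding).** There is an activation sequence $(I_t)_{t\ge1}$ such that the following holds for every $\nu>0$ and every gradient-oblivious algorithm with a deterministic encoding with $k=\lfloor b/D\rfloor$ bits per gradient that satisfies, for all $T$, $\mathcal R_T(0)\le\nu$ for all convex $G$-Lipschitz losses and all choices of subgradients. For every $U\ge 0$ there is a $T_0$ such that for every $T\ge T_0$ there is a comparator $u\in\mathbb R^d$ with $\|u\|=U$ and $$\sup\ \mathcal R_T(u)\ \ge\ \max\left(0.15\,\|u\|\,G\sqrt{D\,T\,\ln\left(\frac{\|u\|^2\,T}{72\,\nu^2 D}\right)},\ \ T\,2^{-b/(dD)}\,\|u\|\,G\right),$$ where the supremum is over all convex $G$-Lipschitz losses and all choices of subgradients, and the first entry of the maximum is read as $0$ if $U=0$. -/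

import Mathlib

open scoped NNReal

/-- A gradient-oblivious algorithm in `ℝᵈ`, for a network with node set `V`, that uses a deterministic
encoding with `k` bits per gradient. Only the values of `encode` on the ball of radius `G` that holds
the gradients matter. The prediction of a node in a round may depend on the node, on the
round, and on the decoded gradients that the node holds at that time, tagged with the round in
which they were produced (`none`: no gradient of that round is held). The true gradients
are never used. -/
structure GradObliviousAlg (V : Type*) (d k : ℕ) where
  encode : EuclideanSpace ℝ (Fin d) → (Fin k → Bool)
  decode : (Fin k → Bool) → EuclideanSpace ℝ (Fin d)
  predict : V → ℕ → (ℕ → Option (EuclideanSpace ℝ (Fin d))) → EuclideanSpace ℝ (Fin d)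

/-- Node `n` holds, when it predicts in round `t`, the encoded gradient produced by the active
node `I s` in round `s`: messages are sent to the neighbours at the end of each round, and every
gradient is forwarded at once, so it travels one edge per round. -/
def Available {V : Type*} (N : SimpleGraph V) (I : ℕ → V) (s t : ℕ) (n : V) : Prop :=
  s < t ∧ N.dist (I s) n ≤ t - s

namespace GradObliviousAlg

variable {V : Type*} {d k : ℕ}

open Classical in
/-- The prediction `w_t` of the active node `I t`, when the gradients are `g 0, g 1, …`
(only those of earlier rounds have an influence). -/
noncomputable def play (A : GradObliviousAlg V d k) (N : SimpleGraph V) (I : ℕ → V)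
    (g : ℕ → EuclideanSpace ℝ (Fin d)) (t : ℕ) : EuclideanSpace ℝ (Fin d) :=
  A.predict (I t) t
    (fun s => if Available N I s t (I t) then some (A.decode (A.encode (g s))) else none)

/-- An admissible behaviour of the adversary in the rounds `0, …, T - 1`: convex `G`-Lipschitz
losses `ℓ t`, and as feedback a subgradient `g t` of `ℓ t` at the prediction of round `t`. -/
def IsAdmissible (A : GradObliviousAlg V d k) (N : SimpleGraph V) (I : ℕ → V) (G : ℝ≥0) (T : ℕ)
    (ℓ : ℕ → EuclideanSpace ℝ (Fin d) → ℝ) (g : ℕ → EuclideanSpace ℝ (Fin d)) : Prop :=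
  ∀ t < T, ConvexOn ℝ Set.univ (ℓ t) ∧ LipschitzWith G (ℓ t) ∧
    ∀ x, ℓ t (A.play N I g t) + inner ℝ (g t) (x - A.play N I g t) ≤ ℓ t x

/-- The joint regret `R_T(u)`. -/
noncomputable def regret (A : GradObliviousAlg V d k) (N : SimpleGraph V) (I : ℕ → V) (T : ℕ)
    (ℓ : ℕ → EuclideanSpace ℝ (Fin d) → ℝ) (g : ℕ → EuclideanSpace ℝ (Fin d))
    (u : EuclideanSpace ℝ (Fin d)) : ℝ :=
  ∑ t ∈ Finset.range T, (ℓ t (A.play N I g t) - ℓ t u)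

/-- The supremum of `R_T(u)` over all `G`-Lipschitz losses (and all admissible subgradients). -/
noncomputable def supRegret (A : GradObliviousAlg V d k) (N : SimpleGraph V) (I : ℕ → V)
    (G : ℝ≥0) (T : ℕ) (u : EuclideanSpace ℝ (Fin d)) : EReal :=
  ⨆ (ℓ : ℕ → EuclideanSpace ℝ (Fin d) → ℝ) (g : ℕ → EuclideanSpace ℝ (Fin d))
    (_ : A.IsAdmissible N I G T ℓ g), ((A.regret N I T ℓ g u : ℝ) : EReal)

end GradObliviousAlg

/-! For large `T` the linear entry of the maximum exceeds the logarithmic one, so `T₀` is chosen to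
this effect and it remains to force regret `T r U G` with `r = 2^(-b/(dD))`. One node that is active
in all rounds suffices for this. The code splits the unit ball (gradients divided by `G`) into `N =
2^k` cells with `N r^d ≤ 1`, and the predictions depend on the gradients only through their cells.

The adversary therefore commits in each round only to a cell `c_t` and picks the gradients inside
the cells at the very end. Against `u = -U v` with `‖v‖ = 1` these can be picked so that the regret
comes arbitrarily close to `G U ∑ h_{c_t}(w_t / U + v)`, where `h_c` is the support function of the
cell. If for every `w` some cell has a mean of `h_c(w + v)` over the sphere of at least `r`
(`exists_cell_le_integral_supportFn`), then averaging the sum over `v` gives one `v` that is good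
for all rounds together.

If `‖w‖ ≥ r`, the cell of `w / ‖w‖` works, since linear functions have mean zero on the sphere. If
`w = 0`, this is Urysohn's inequality for a cell whose closed convex hull `K` has a large volume.
For other `w` the Minkowski sum is deformed: `y ∈ K` acts on the unit ball `B` by `x ↦ (1 + t⟪w, y⟫)
x + t y`. The image has radius at most `1 + t h(w + v)` in the direction `v`, so the first order in
`t` of its volume is controlled by the mean of `h`. Conversely, monotone transport between the
slices of `B` and `K` orthogonal to `w` (`lintegral_slices_le`) shows that this volume is at least
`(1 + t r)^d` times that of `B`, provided that `∫_B 1/(1 + ⟪w, x⟫) ≤ ∫_K 1/(r - ⟪w, y⟫)^d`. By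
pigeonhole some cell satisfies this, because `N` times the left side is at most the right side taken
over all of `B`. -/

/-! ### Monotone transport and the one-dimensional inequality. -/

open MeasureTheory Set in
/-- A primitive of a positive continuous integrable function on an interval. -/
lemma exists_primitive_strictMonoOn {c e : ℝ} (hce : c < e) {β : ℝ → ℝ}
    (hc : ContinuousOn β (Ioo c e)) (hpos : ∀ x ∈ Ioo c e, 0 < β x)
    (hi : IntegrableOn β (Ioo c e)) :
    ∃ B : ℝ → ℝ, ContinuousOn B (Icc c e) ∧ StrictMonoOn B (Icc c e) ∧
      (∀ x ∈ Ioo c e, HasDerivAt B (β x) x) ∧ B c = 0 ∧ B e = ∫ x in Ioo c e, β x := by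
  have hi' : IntervalIntegrable β volume c e := by
    rw [intervalIntegrable_iff_integrableOn_Ioo_of_le hce.le]; exact hi
  have hd : ∀ x ∈ Ioo c e, HasDerivAt (fun u => ∫ t in c..u, β t) (β x) x := by
    intro x hx
    have hn : Ioo c e ∈ nhds x := isOpen_Ioo.mem_nhds hx
    refine intervalIntegral.integral_hasDerivAt_right ?_ ?_ (hc.continuousAt hn)
    · refine hi'.mono_set ?_
      rw [uIcc_of_le hx.1.le, uIcc_of_le hce.le]
      exact Icc_subset_Icc_right hx.2.le
    · exact hc.stronglyMeasurableAtFilter isOpen_Ioo x hx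
  have hcont : ContinuousOn (fun u => ∫ t in c..u, β t) (Icc c e) := by
    have := intervalIntegral.continuousOn_primitive_interval (μ := volume) (f := β) (a := c) (b := e)
      (by rw [uIcc_of_le hce.le]; exact (integrableOn_Icc_iff_integrableOn_Ioo).2 hi)
    rwa [uIcc_of_le hce.le] at this
  refine ⟨fun u => ∫ t in c..u, β t, hcont, ?_, hd, by simp, ?_⟩
  · refine strictMonoOn_of_deriv_pos (convex_Icc c e) hcont ?_
    intro x hx
    rw [interior_Icc] at hx
    rw [(hd x hx).deriv]
    exact hpos x hx
  · simp only
    rw [intervalIntegral.integral_of_le hce.le, integral_Ioc_eq_integral_Ioo]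

open MeasureTheory Set in
/-- Monotone transport of a density `α` on an interval to a part of a density `β`. -/
lemma exists_monotone_transport {a b c e : ℝ} (hab : a < b) (hce : c < e) {α β : ℝ → ℝ}
    (hαc : ContinuousOn α (Ioo a b)) (hα : ∀ x ∈ Ioo a b, 0 < α x) (hαi : IntegrableOn α (Ioo a b))
    (hβc : ContinuousOn β (Ioo c e)) (hβ : ∀ x ∈ Ioo c e, 0 < β x) (hβi : IntegrableOn β (Ioo c e))
    (hle : ∫ x in Ioo a b, α x ≤ ∫ x in Ioo c e, β x) :
    ∃ T : ℝ → ℝ, ∀ s ∈ Ioo a b, T s ∈ Ioo c e ∧ HasDerivAt T (α s / β (T s)) s := by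
  obtain ⟨A, hA1, hA2, hA3, hA4, hA5⟩ := exists_primitive_strictMonoOn hab hαc hα hαi
  obtain ⟨B, hB1, hB2, hB3, hB4, hB5⟩ := exists_primitive_strictMonoOn hce hβc hβ hβi
  have himg : B '' Ioo c e = Ioo 0 (B e) := by
    apply Subset.antisymm
    · rintro _ ⟨x, hx, rfl⟩
      refine ⟨?_, ?_⟩
      · rw [← hB4]; exact hB2 ⟨le_rfl, hce.le⟩ ⟨hx.1.le, hx.2.le⟩ hx.1
      · exact hB2 ⟨hx.1.le, hx.2.le⟩ ⟨hce.le, le_rfl⟩ hx.2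
    · rw [← hB4]; exact intermediate_value_Ioo hce.le hB1
  have hAm : ∀ s ∈ Ioo a b, A s ∈ Ioo 0 (B e) := by
    intro s hs
    refine ⟨?_, ?_⟩
    · rw [← hA4]; exact hA2 ⟨le_rfl, hab.le⟩ ⟨hs.1.le, hs.2.le⟩ hs.1
    · refine lt_of_lt_of_le (hA2 ⟨hs.1.le, hs.2.le⟩ ⟨hab.le, le_rfl⟩ hs.2) ?_
      rw [hA5, hB5]; exact hle
  -- The transport is `B⁻¹ ∘ A`. As `α` has at most the mass of `β`, the values of `A` stay in the
  -- range of `B`.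
  set J : ℝ → ℝ := Function.invFunOn B (Ioo c e) with hJ
  have hJm : ∀ m ∈ Ioo 0 (B e), J m ∈ Ioo c e ∧ B (J m) = m := by
    intro m hm
    rw [← himg] at hm
    exact ⟨Function.invFunOn_mem hm, Function.invFunOn_eq hm⟩
  have hB2' : StrictMonoOn B (Ioo c e) := hB2.mono Ioo_subset_Icc_self
  have hJmono : StrictMonoOn J (Ioo 0 (B e)) := by
    intro m hm m' hm' hlt
    rw [← hB2'.lt_iff_lt (hJm m hm).1 (hJm m' hm').1, (hJm m hm).2, (hJm m' hm').2]
    exact hlt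
  have hJimg : J '' Ioo 0 (B e) = Ioo c e := by
    apply Subset.antisymm
    · rintro _ ⟨m, hm, rfl⟩; exact (hJm m hm).1
    · intro x hx
      have hBx : B x ∈ Ioo 0 (B e) := by rw [← himg]; exact ⟨x, hx, rfl⟩
      exact ⟨B x, hBx, hB2'.injOn (hJm _ hBx).1 hx (hJm _ hBx).2⟩
  have hJd : ∀ m ∈ Ioo 0 (B e), HasDerivAt J (β (J m))⁻¹ m := by
    intro m hm
    have hn : Ioo 0 (B e) ∈ nhds m := isOpen_Ioo.mem_nhds hm
    refine HasDerivAt.of_local_left_inverse ?_ (hB3 _ (hJm m hm).1) (hβ _ (hJm m hm).1).ne' ?_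
    · refine hJmono.continuousAt_of_image_mem_nhds hn ?_
      rw [hJimg]; exact isOpen_Ioo.mem_nhds (hJm m hm).1
    · filter_upwards [hn] with y hy using (hJm y hy).2
  refine ⟨fun s => J (A s), fun s hs => ⟨(hJm _ (hAm s hs)).1, ?_⟩⟩
  have := (hJd _ (hAm s hs)).comp s (hA3 s hs)
  rw [div_eq_inv_mul]
  exact this

/-- Jensen for the power `n + 1` at the points `1` and `D / x` with weights proportional to `P` and
`x`. On the right stand the Jacobian of the transport and the volume of a combined slice, relative
to `f ^ n`. -/
lemma pow_succ_add_le {P D x : ℝ} (hP : 0 < P) (hD : 0 < D) (hx : 0 < x) (n : ℕ) :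
    (P + D) ^ (n + 1) ≤ (P + D ^ (n + 1) / x ^ n) * (P + x) ^ n := by
  have h := (convexOn_pow (𝕜 := ℝ) (n + 1)).2 (show (1 : ℝ) ∈ Set.Ici 0 by simp)
    (show D / x ∈ Set.Ici 0 from (div_pos hD hx).le)
    (show 0 ≤ P / (P + x) by positivity) (show 0 ≤ x / (P + x) by positivity) (by field_simp)
  simp only [smul_eq_mul, one_pow, mul_one] at h
  have e1 : P / (P + x) + x / (P + x) * (D / x) = (P + D) / (P + x) := by field_simp
  have e2 : P / (P + x) + x / (P + x) * (D / x) ^ (n + 1) =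
      (P + D ^ (n + 1) / x ^ n) / (P + x) := by
    rw [div_pow, pow_succ x]; field_simp
  rw [e1, e2, div_pow, div_le_div_iff₀ (by positivity) (by positivity)] at h
  have hpx : 0 < P + x := by positivity
  rw [pow_succ (P + x), ← mul_assoc] at h
  exact le_of_mul_le_mul_right h hpx

open MeasureTheory Set in
/-- The one-dimensional step of the Brunn-Minkowski type inequality: `f` and `g` are the radii of
the slices of two bodies and `H` bounds the volumes of the slices of the combined body. -/
lemma lintegral_slices_le {a b c e ω R : ℝ} {n : ℕ} {f g : ℝ → ℝ} (hab : a < b) (hce : c < e)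
    (hfc : ContinuousOn f (Ioo a b)) (hf : ∀ s ∈ Ioo a b, 0 < f s)
    (hgc : ContinuousOn g (Ioo c e)) (hg : ∀ τ ∈ Ioo c e, 0 < g τ)
    (h1 : ∀ s ∈ Ioo a b, 0 < 1 + ω * s) (h2 : ∀ τ ∈ Ioo c e, 0 < 1 + ω * τ)
    (h3 : ∀ τ ∈ Ioo c e, 0 < R - ω * τ)
    (hle : ∫⁻ s in Ioo a b, ENNReal.ofReal (f s ^ n / (1 + ω * s)) ≤
      ∫⁻ τ in Ioo c e, ENNReal.ofReal (g τ ^ n / (R - ω * τ) ^ (n + 1)))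
    (hfin : ∫⁻ τ in Ioo c e, ENNReal.ofReal (g τ ^ n / (R - ω * τ) ^ (n + 1)) ≠ ⊤)
    {H : ℝ → ENNReal}
    (hH : ∀ s ∈ Ioo a b, ∀ τ ∈ Ioo c e,
      ENNReal.ofReal (((1 + ω * τ) * f s + g τ) ^ n) ≤ H (s + τ * (1 + ω * s))) :
    ∫⁻ s in Ioo a b, ENNReal.ofReal ((1 + R) ^ (n + 1) * f s ^ n) ≤ ∫⁻ z, H z := by
  -- These densities are tuned to the pointwise estimate below: the factor `1 + ω s` cancels in the
  -- Jacobian `z'`, and the power of `R - ω τ` is the one that Jensen's inequality needs.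
  set α : ℝ → ℝ := fun s => f s ^ n / (1 + ω * s) with hαdef
  set β : ℝ → ℝ := fun τ => g τ ^ n / (R - ω * τ) ^ (n + 1) with hβdef
  have hαpos : ∀ s ∈ Ioo a b, 0 < α s := fun s hs => div_pos (pow_pos (hf s hs) n) (h1 s hs)
  have hβpos : ∀ s ∈ Ioo c e, 0 < β s :=
    fun s hs => div_pos (pow_pos (hg s hs) n) (pow_pos (h3 s hs) _)
  have hαc : ContinuousOn α (Ioo a b) :=
    (hfc.pow n).div (by fun_prop) fun s hs => (h1 s hs).ne'
  have hβc : ContinuousOn β (Ioo c e) :=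
    (hgc.pow n).div (by fun_prop) fun s hs => (pow_pos (h3 s hs) _).ne'
  have hαnn : 0 ≤ᵐ[volume.restrict (Ioo a b)] α := by
    filter_upwards [ae_restrict_mem measurableSet_Ioo] with s hs using (hαpos s hs).le
  have hβnn : 0 ≤ᵐ[volume.restrict (Ioo c e)] β := by
    filter_upwards [ae_restrict_mem measurableSet_Ioo] with s hs using (hβpos s hs).le
  have hαm := hαc.aestronglyMeasurable (μ := volume) measurableSet_Ioo
  have hβm := hβc.aestronglyMeasurable (μ := volume) measurableSet_Ioo
  have hαi : IntegrableOn α (Ioo a b) :=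
    (lintegral_ofReal_ne_top_iff_integrable hαm hαnn).1 (ne_top_of_le_ne_top hfin hle)
  have hβi : IntegrableOn β (Ioo c e) := (lintegral_ofReal_ne_top_iff_integrable hβm hβnn).1 hfin
  have hle' : ∫ x in Ioo a b, α x ≤ ∫ x in Ioo c e, β x := by
    rw [integral_eq_lintegral_of_nonneg_ae hαnn hαm, integral_eq_lintegral_of_nonneg_ae hβnn hβm]
    exact ENNReal.toReal_mono hfin hle
  obtain ⟨T, hT⟩ := exists_monotone_transport hab hce hαc hαpos hαi hβc hβpos hβi hle'
  set z : ℝ → ℝ := fun s => s + T s * (1 + ω * s) with hz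
  set z' : ℝ → ℝ := fun s => 1 + (α s / β (T s) * (1 + ω * s) + T s * ω) with hz'
  have hzd : ∀ s ∈ Ioo a b, HasDerivAt z (z' s) s := by
    intro s hs
    have hlin : HasDerivAt (fun s : ℝ => 1 + ω * s) ω s := by
      simpa using ((hasDerivAt_id s).const_mul ω).const_add 1
    exact (hasDerivAt_id s).add ((hT s hs).2.mul hlin)
  have hz'pos : ∀ s ∈ Ioo a b, 0 < z' s := by
    intro s hs
    have e1 := h2 _ (hT s hs).1
    have : 0 < α s / β (T s) * (1 + ω * s) :=
      mul_pos (div_pos (hαpos s hs) (hβpos _ (hT s hs).1)) (h1 s hs)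
    simp only [hz']
    nlinarith
  have hzinj : InjOn z (Ioo a b) := by
    apply StrictMonoOn.injOn
    refine strictMonoOn_of_deriv_pos (convex_Ioo a b)
      (fun s hs => (hzd s hs).continuousAt.continuousWithinAt) ?_
    intro s hs
    rw [interior_Ioo] at hs
    rw [(hzd s hs).deriv]; exact hz'pos s hs
  calc ∫⁻ s in Ioo a b, ENNReal.ofReal ((1 + R) ^ (n + 1) * f s ^ n)
      ≤ ∫⁻ s in Ioo a b, ENNReal.ofReal |z' s| * H (z s) := by
        refine setLIntegral_mono' measurableSet_Ioo fun s hs => ?_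
        have hTs := (hT s hs).1
        refine le_trans ?_ (mul_le_mul_right (hH s hs (T s) hTs) _)
        rw [← ENNReal.ofReal_mul (abs_nonneg _), abs_of_pos (hz'pos s hs)]
        apply ENNReal.ofReal_le_ofReal
        have hP := h2 _ hTs
        have hD := h3 _ hTs
        have hfs := hf s hs
        have hgs := hg _ hTs
        have h1s := h1 s hs
        have key := pow_succ_add_le hP hD (div_pos hgs hfs) n
        -- The sum no longer depends on the position of the slices, which is why the final bound has
        -- a constant factor.
        have e0 : 1 + ω * T s + (R - ω * T s) = 1 + R := by ring
        rw [e0] at key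
        have e1 : z' s = 1 + ω * T s + (R - ω * T s) ^ (n + 1) / (g (T s) / f s) ^ n := by
          simp only [hz', hαdef, hβdef, div_pow]
          field_simp
          ring
        have e2 : (1 + ω * T s) * f s + g (T s) = (1 + ω * T s + g (T s) / f s) * f s := by
          field_simp
        rw [e1, e2, mul_pow, ← mul_assoc]
        exact mul_le_mul_of_nonneg_right key (by positivity)
    _ = ∫⁻ x in z '' Ioo a b, H x :=
        (lintegral_image_eq_lintegral_abs_deriv_mul measurableSet_Ioo
          (fun s hs => (hzd s hs).hasDerivWithinAt) hzinj H).symm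
    _ ≤ ∫⁻ z, H z := setLIntegral_le_lintegral _ _

/-! ### Slices of convex bodies. -/

section BrunnMinkowski

open MeasureTheory Set

/-- The slice of a subset of `ℝⁿ⁺¹` over a value of the first coordinate. -/
def slice {n : ℕ} (S : Set (Fin (n + 1) → ℝ)) (s : ℝ) : Set (Fin n → ℝ) :=
  {x | (Fin.cons s x : Fin (n + 1) → ℝ) ∈ S}

lemma isometry_finCons {n : ℕ} (s : ℝ) :
    Isometry (fun x : Fin n → ℝ => (Fin.cons s x : Fin (n + 1) → ℝ)) := by
  refine Isometry.of_dist_eq fun x y => ?_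
  refine le_antisymm ((dist_pi_le_iff dist_nonneg).2 fun i => ?_)
    ((dist_pi_le_iff dist_nonneg).2 fun i => ?_)
  · refine Fin.cases ?_ (fun i => ?_) i
    · simp
    · simpa using dist_le_pi_dist x y i
  · simpa using dist_le_pi_dist (Fin.cons s x : Fin (n + 1) → ℝ) (Fin.cons s y : Fin (n + 1) → ℝ)
      i.succ

lemma IsCompact.slice {n : ℕ} {S : Set (Fin (n + 1) → ℝ)} (hS : IsCompact S) (s : ℝ) :
    IsCompact (slice S s) :=
  (isometry_finCons s).isClosedEmbedding.isCompact_preimage hS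

lemma MeasurableSet.slice {n : ℕ} {S : Set (Fin (n + 1) → ℝ)} (hS : MeasurableSet S) (s : ℝ) :
    MeasurableSet (slice S s) :=
  (isometry_finCons s).continuous.measurable hS

lemma finCons_combo {n : ℕ} (a b s t : ℝ) (x y : Fin n → ℝ) :
    (Fin.cons (a * s + b * t) (a • x + b • y) : Fin (n + 1) → ℝ) =
      a • (Fin.cons s x : Fin (n + 1) → ℝ) + b • (Fin.cons t y : Fin (n + 1) → ℝ) := by
  ext i
  refine Fin.cases ?_ (fun i => ?_) i <;> simp

lemma Convex.slice {n : ℕ} {S : Set (Fin (n + 1) → ℝ)} (hS : Convex ℝ S) (s : ℝ) :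
    Convex ℝ (slice S s) := by
  intro x hx y hy a b ha hb hab
  have := finCons_combo a b s s x y
  rw [← add_mul, hab, one_mul] at this
  change (Fin.cons s (a • x + b • y) : Fin (n + 1) → ℝ) ∈ S
  rw [this]
  exact hS hx hy ha hb hab

lemma lintegral_comp_zero_eq_lintegral_slice {n : ℕ} {S : Set (Fin (n + 1) → ℝ)}
    (hS : MeasurableSet S) {φ : ℝ → ENNReal} (hφ : Measurable φ) :
    ∫⁻ x in S, φ (x 0) = ∫⁻ s, φ s * volume (slice S s) := by
  set e := MeasurableEquiv.piFinSuccAbove (fun _ : Fin (n + 1) => ℝ) 0 with he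
  have hmp : MeasurePreserving e := volume_preserving_piFinSuccAbove (fun _ => ℝ) 0
  have hmeas : Measurable (S.indicator fun x : Fin (n + 1) → ℝ => φ (x 0)) :=
    (hφ.comp (measurable_pi_apply 0)).indicator hS
  rw [← lintegral_indicator hS, ← hmp.symm.lintegral_comp hmeas,
    Measure.volume_eq_prod, 
    lintegral_prod (fun z => S.indicator (fun x : Fin (n + 1) → ℝ => φ (x 0)) (e.symm z))
      (hmeas.comp e.symm.measurable).aemeasurable]
  refine lintegral_congr fun s => ?_
  have hsymm : ∀ x : Fin n → ℝ, e.symm (s, x) = (Fin.cons s x : Fin (n + 1) → ℝ) := by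
    intro x
    rw [MeasurableEquiv.symm_apply_eq]
    ext i
    · simp [e]
    · simp [e]
  rw [← lintegral_indicator_const (hS.slice s)]
  refine lintegral_congr fun x => ?_
  rw [hsymm]
  by_cases hx : (Fin.cons s x : Fin (n + 1) → ℝ) ∈ S
  · rw [indicator_of_mem hx, indicator_of_mem (show x ∈ slice S s from hx)]; simp
  · rw [indicator_of_notMem hx, indicator_of_notMem (show x ∉ slice S s from hx)]

lemma volume_eq_lintegral_slice {n : ℕ} {S : Set (Fin (n + 1) → ℝ)} (hS : MeasurableSet S) :
    volume S = ∫⁻ s, volume (slice S s) := by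
  simpa using lintegral_comp_zero_eq_lintegral_slice hS (φ := fun _ => 1) measurable_const

open scoped Pointwise in
/-- The Brunn-Minkowski inequality for compact convex sets in `ℝⁿ`. -/
def BrunnMinkowski (n : ℕ) : Prop :=
  ∀ X K : Set (Fin n → ℝ), IsCompact X → Convex ℝ X → IsCompact K → Convex ℝ K →
    ∀ p q : ℝ, 0 < p → 0 < q → ENNReal.ofReal (p ^ n) ≤ volume X →
      ENNReal.ofReal (q ^ n) ≤ volume K → ENNReal.ofReal ((p + q) ^ n) ≤ volume (X + K)

/-- The volume radius of a set in `ℝⁿ`, normalised by the cube. -/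
noncomputable def volRadius {n : ℕ} (S : Set (Fin n → ℝ)) : ℝ :=
  (volume S).toReal ^ ((n : ℝ)⁻¹)

lemma volume_eq_volRadius_pow {n : ℕ} {S : Set (Fin n → ℝ)} (hS : IsCompact S)
    (h0 : 0 < volume S) : volume S = ENNReal.ofReal (volRadius S ^ n) := by
  rcases Nat.eq_zero_or_pos n with rfl | hn
  · have hne : S.Nonempty := nonempty_of_measure_ne_zero h0.ne'
    have : S = univ := Subsingleton.eq_univ_of_nonempty hne
    rw [this]; simp [volume_pi]
  · rw [volRadius, Real.rpow_inv_natCast_pow ENNReal.toReal_nonneg hn.ne',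
      ENNReal.ofReal_toReal hS.measure_lt_top.ne]

lemma volRadius_pos {n : ℕ} {S : Set (Fin n → ℝ)} (hS : IsCompact S)
    (h0 : 0 < volume S) : 0 < volRadius S :=
  Real.rpow_pos_of_pos (ENNReal.toReal_pos h0.ne' hS.measure_lt_top.ne) _

lemma volume_smul_eq {n : ℕ} {S : Set (Fin n → ℝ)} (hS : IsCompact S)
    (h0 : 0 < volume S) {a : ℝ} (ha : 0 ≤ a) :
    volume ((fun x => a • x) '' S) = ENNReal.ofReal ((a * volRadius S) ^ n) := by
  have := Measure.addHaar_smul_of_nonneg (volume : Measure (Fin n → ℝ)) ha S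
  rw [← image_smul] at this
  rw [this, volume_eq_volRadius_pow hS h0, mul_pow, ENNReal.ofReal_mul (by positivity)]
  simp

lemma le_volRadius {n : ℕ} (hn : n ≠ 0) {S : Set (Fin n → ℝ)} (hS : IsCompact S) {p : ℝ}
    (hp : 0 ≤ p) (h : ENNReal.ofReal (p ^ n) ≤ volume S) : p ≤ volRadius S := by
  have h1 : p ^ n ≤ (volume S).toReal :=
    (ENNReal.ofReal_le_iff_le_toReal hS.measure_lt_top.ne).1 h
  calc p = (p ^ n) ^ ((n : ℝ)⁻¹) := (Real.pow_rpow_inv_natCast hp hn).symm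
    _ ≤ _ := Real.rpow_le_rpow (by positivity) h1 (by positivity)

open scoped Pointwise in
lemma BrunnMinkowski.smul_add_smul {n : ℕ} (hBM : BrunnMinkowski n) {X K : Set (Fin n → ℝ)}
    (hX : IsCompact X) (hXc : Convex ℝ X) (hK : IsCompact K) (hKc : Convex ℝ K)
    (hX0 : 0 < volume X) (hK0 : 0 < volume K) {a b : ℝ} (ha : 0 < a) (hb : 0 < b) :
    ENNReal.ofReal ((a * volRadius X + b * volRadius K) ^ n) ≤ volume (a • X + b • K) := by
  refine hBM _ _ (hX.smul a) (hXc.smul a) (hK.smul b) (hKc.smul b) _ _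
    (mul_pos ha (volRadius_pos hX hX0)) (mul_pos hb (volRadius_pos hK hK0)) ?_ ?_
  · rw [← volume_smul_eq hX hX0 ha.le]; rfl
  · rw [← volume_smul_eq hK hK0 hb.le]; rfl

open scoped Pointwise in
lemma slice_combo_subset {n : ℕ} {X : Set (Fin (n + 1) → ℝ)} (hX : Convex ℝ X) {a b s t : ℝ}
    (ha : 0 ≤ a) (hb : 0 ≤ b) (hab : a + b = 1) :
    a • slice X s + b • slice X t ⊆ slice X (a * s + b * t) := by
  rintro _ ⟨_, ⟨x, hx, rfl⟩, _, ⟨y, hy, rfl⟩, rfl⟩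
  change (Fin.cons (a * s + b * t) (a • x + b • y) : Fin (n + 1) → ℝ) ∈ X
  rw [finCons_combo]
  exact hX hx hy ha hb hab

/-- Brunn's theorem. It is needed for the continuity of the radii of the slices, without which the
transport would not be differentiable. -/
lemma BrunnMinkowski.concaveOn_volRadius_slice {n : ℕ} (hBM : BrunnMinkowski n)
    {X : Set (Fin (n + 1) → ℝ)} (hX : IsCompact X) (hXc : Convex ℝ X) :
    ConcaveOn ℝ {s | 0 < volume (slice X s)} fun s => volRadius (slice X s) := by
  have key : ∀ s t a b : ℝ, 0 < volume (slice X s) → 0 < volume (slice X t) → 0 < a → 0 < b →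
      a + b = 1 → ENNReal.ofReal ((a * volRadius (slice X s) + b * volRadius (slice X t)) ^ n) ≤
        volume (slice X (a * s + b * t)) := fun s t a b hs ht ha hb hab =>
    (hBM.smul_add_smul (hX.slice s) (hXc.slice s) (hX.slice t) (hXc.slice t) hs ht ha hb).trans
      (measure_mono (slice_combo_subset hXc ha.le hb.le hab))
  have hpos : ∀ s t a b : ℝ, 0 < volume (slice X s) → 0 < volume (slice X t) → 0 < a → 0 < b →
      0 < a * volRadius (slice X s) + b * volRadius (slice X t) := fun s t a b hs ht ha hb =>
    add_pos (mul_pos ha (volRadius_pos (hX.slice s) hs)) (mul_pos hb (volRadius_pos (hX.slice t) ht))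
  refine ⟨convex_iff_forall_pos.2 fun s hs t ht a b ha hb hab => ?_,
    fun s hs t ht a b ha hb hab => ?_⟩
  · refine lt_of_lt_of_le ?_ (key s t a b hs ht ha hb hab)
    exact ENNReal.ofReal_pos.2 (pow_pos (hpos s t a b hs ht ha hb) n)
  · rcases ha.eq_or_lt with rfl | ha
    · have : b = 1 := by linarith
      subst this; simp
    rcases hb.eq_or_lt with rfl | hb
    · have : a = 1 := by linarith
      subst this; simp
    -- In dimension `0` the exponent `n⁻¹` is `0`, so all radii equal `1`.
    rcases eq_or_ne n 0 with rfl | hn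
    · simp [volRadius, hab]
    · exact le_volRadius hn (hX.slice _) (hpos s t a b hs ht ha hb).le (key s t a b hs ht ha hb hab)

/-- The slices of a convex body have positive volume over an interval. -/
lemma BrunnMinkowski.exists_Ioo_slice {n : ℕ} (hBM : BrunnMinkowski n)
    {X : Set (Fin (n + 1) → ℝ)} (hX : IsCompact X) (hXc : Convex ℝ X) (hX0 : 0 < volume X) :
    ∃ a b : ℝ, a < b ∧ ContinuousOn (fun s => volRadius (slice X s)) (Ioo a b) ∧
      (∀ s ∈ Ioo a b, 0 < volume (slice X s)) ∧
      (∀ s, s ∉ Icc a b → volume (slice X s) = 0) := by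
  set I : Set ℝ := {s | 0 < volume (slice X s)} with hI
  have hconc := hBM.concaveOn_volRadius_slice hX hXc
  have hsub : I ⊆ (fun x : Fin (n + 1) → ℝ => x 0) '' X := by
    intro s hs
    obtain ⟨x, hx⟩ := nonempty_of_measure_ne_zero (ne_of_gt hs)
    exact ⟨_, hx, by simp⟩
  have hbdd : Bornology.IsBounded I :=
    (hX.image (continuous_apply 0)).isBounded.subset hsub
  have hne : I.Nonempty := by
    by_contra h
    rw [not_nonempty_iff_eq_empty] at h
    have h0 : ∀ s, volume (slice X s) = 0 := fun s => by
      by_contra hs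
      exact (h ▸ (show s ∈ I from pos_iff_ne_zero.2 hs) : s ∈ (∅ : Set ℝ))
    rw [volume_eq_lintegral_slice hX.measurableSet] at hX0
    simp [h0] at hX0
  have hb := hbdd.bddBelow
  have ha := hbdd.bddAbove
  have hIcc : I ⊆ Icc (sInf I) (sSup I) := subset_Icc_csInf_csSup hb ha
  have hIoo : Ioo (sInf I) (sSup I) ⊆ I :=
    IsConnected.Ioo_csInf_csSup_subset ⟨hne, hconc.1.isPreconnected⟩ hb ha
  refine ⟨sInf I, sSup I, ?_, ?_, fun s hs => hIoo hs, fun s hs => ?_⟩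
  · by_contra hlt
    rw [volume_eq_lintegral_slice hX.measurableSet] at hX0
    -- Otherwise at most one slice would have positive volume, and `X` would be null by Fubini.
    have : (fun s => volume (slice X s)) =ᵐ[volume] fun _ => 0 := by
      have hae : ∀ᵐ s : ℝ, s ≠ sInf I := by simp [ae_iff]
      filter_upwards [hae] with s hs
      by_contra h0
      have := hIcc (show s ∈ I from pos_iff_ne_zero.2 h0)
      exact hs (le_antisymm (this.2.trans (not_lt.1 hlt)) this.1)
    rw [lintegral_congr_ae this] at hX0
    simp at hX0
  · exact hconc.continuousOn_interior.mono (isOpen_Ioo.subset_interior_iff.2 hIoo)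
  · by_contra h0
    exact hs (hIcc (show s ∈ I from pos_iff_ne_zero.2 h0))

lemma lintegral_slice_eq_Ioo {n : ℕ} {X : Set (Fin (n + 1) → ℝ)} (hX : IsCompact X) {a b : ℝ}
    (hpos : ∀ s ∈ Ioo a b, 0 < volume (slice X s))
    (hz : ∀ s, s ∉ Icc a b → volume (slice X s) = 0) {φ : ℝ → ℝ} (hφ : Measurable φ)
    (hφ0 : ∀ s ∈ Ioo a b, 0 ≤ φ s) :
    ∫⁻ x in X, ENNReal.ofReal (φ (x 0)) =
      ∫⁻ s in Ioo a b, ENNReal.ofReal (φ s * volRadius (slice X s) ^ n) := by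
  rw [lintegral_comp_zero_eq_lintegral_slice hX.measurableSet (φ := fun s => ENNReal.ofReal (φ s))
    hφ.ennreal_ofReal]
  have h1 : ∫⁻ s, ENNReal.ofReal (φ s) * volume (slice X s) =
      ∫⁻ s in Icc a b, ENNReal.ofReal (φ s) * volume (slice X s) := by
    rw [← lintegral_indicator measurableSet_Icc]
    refine lintegral_congr fun s => ?_
    by_cases hs : s ∈ Icc a b
    · rw [indicator_of_mem hs]
    · rw [indicator_of_notMem hs, hz s hs, mul_zero]
  rw [h1, ← restrict_Ioo_eq_restrict_Icc]
  refine setLIntegral_congr_fun measurableSet_Ioo fun s hs => ?_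
  rw [volume_eq_volRadius_pow (hX.slice s) (hpos s hs), ENNReal.ofReal_mul (hφ0 s hs)]

lemma setLIntegral_ofReal_lt_top_of_isCompact {n : ℕ} {K : Set (Fin n → ℝ)} (hK : IsCompact K)
    {φ : (Fin n → ℝ) → ℝ} (hφ : ContinuousOn φ K) : ∫⁻ x in K, ENNReal.ofReal (φ x) ≠ ⊤ :=
  (hφ.integrableOn_compact hK).lintegral_lt_top.ne

/-! ### The deformed Brunn-Minkowski inequality, and the classical one. -/

/-- A Brunn-Minkowski type inequality for the products of the points of two convex bodies, where
`y` acts as the affine map `x ↦ (1 + ω y₀) x + y`. -/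
theorem BrunnMinkowski.le_volume_image2 {n : ℕ} (hBM : BrunnMinkowski n)
    {X K : Set (Fin (n + 1) → ℝ)} (hX : IsCompact X) (hXc : Convex ℝ X) (hX0 : 0 < volume X)
    (hK : IsCompact K) (hKc : Convex ℝ K) (hK0 : 0 < volume K) {ω R : ℝ}
    (h1 : ∀ x ∈ X, 0 < 1 + ω * x 0) (h2 : ∀ y ∈ K, 0 < 1 + ω * y 0)
    (h3 : ∀ y ∈ K, 0 < R - ω * y 0)
    (hle : ∫⁻ x in X, ENNReal.ofReal (1 / (1 + ω * x 0)) ≤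
      ∫⁻ y in K, ENNReal.ofReal (1 / (R - ω * y 0) ^ (n + 1))) :
    ENNReal.ofReal ((1 + R) ^ (n + 1)) * volume X ≤
      volume (image2 (fun x y => (1 + ω * y 0) • x + y) X K) := by
  obtain ⟨a, b, hab, hfc, hfpos, hf0⟩ := hBM.exists_Ioo_slice hX hXc hX0
  obtain ⟨c, e, hce, hgc, hgpos, hg0⟩ := hBM.exists_Ioo_slice hK hKc hK0
  have hmemX : ∀ s ∈ Ioo a b, ∃ x ∈ X, x 0 = s := fun s hs => by
    obtain ⟨x, hx⟩ := nonempty_of_measure_ne_zero (ne_of_gt (hfpos s hs))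
    exact ⟨_, hx, by simp⟩
  have hmemK : ∀ s ∈ Ioo c e, ∃ x ∈ K, x 0 = s := fun s hs => by
    obtain ⟨x, hx⟩ := nonempty_of_measure_ne_zero (ne_of_gt (hgpos s hs))
    exact ⟨_, hx, by simp⟩
  have h1' : ∀ s ∈ Ioo a b, 0 < 1 + ω * s := fun s hs => by
    obtain ⟨x, hx, rfl⟩ := hmemX s hs; exact h1 x hx
  have h2' : ∀ s ∈ Ioo c e, 0 < 1 + ω * s := fun s hs => by
    obtain ⟨x, hx, rfl⟩ := hmemK s hs; exact h2 x hx
  have h3' : ∀ s ∈ Ioo c e, 0 < R - ω * s := fun s hs => by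
    obtain ⟨x, hx, rfl⟩ := hmemK s hs; exact h3 x hx
  have hR : 0 ≤ 1 + R := by
    obtain ⟨τ, hτ⟩ := nonempty_Ioo.2 hce
    linarith [h2' τ hτ, h3' τ hτ]
  set Z := image2 (fun x y : Fin (n + 1) → ℝ => (1 + ω * y 0) • x + y) X K with hZ
  have hZc : IsCompact Z := by
    rw [hZ, ← image_prod]
    exact (hX.prod hK).image (by fun_prop)
  have hXe : ∫⁻ x in X, ENNReal.ofReal (1 / (1 + ω * x 0)) =
      ∫⁻ s in Ioo a b, ENNReal.ofReal (volRadius (slice X s) ^ n / (1 + ω * s)) := by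
    rw [lintegral_slice_eq_Ioo hX hfpos hf0 (φ := fun s => 1 / (1 + ω * s)) (by fun_prop)
      fun s hs => (one_div_pos.2 (h1' s hs)).le]
    simp only [one_div_mul_eq_div]
  have hKe : ∫⁻ y in K, ENNReal.ofReal (1 / (R - ω * y 0) ^ (n + 1)) =
      ∫⁻ s in Ioo c e, ENNReal.ofReal (volRadius (slice K s) ^ n / (R - ω * s) ^ (n + 1)) := by
    rw [lintegral_slice_eq_Ioo hK hgpos hg0 (φ := fun s => 1 / (R - ω * s) ^ (n + 1)) (by fun_prop)
      fun s hs => (one_div_pos.2 (pow_pos (h3' s hs) _)).le]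
    simp only [one_div_mul_eq_div]
  have hfin : ∫⁻ y in K, ENNReal.ofReal (1 / (R - ω * y 0) ^ (n + 1)) ≠ ⊤ := by
    refine setLIntegral_ofReal_lt_top_of_isCompact hK ?_
    exact ContinuousOn.div (by fun_prop) (by fun_prop) fun y hy => (pow_pos (h3 y hy) _).ne'
  have hVX : ENNReal.ofReal ((1 + R) ^ (n + 1)) * volume X =
      ∫⁻ s in Ioo a b, ENNReal.ofReal ((1 + R) ^ (n + 1) * volRadius (slice X s) ^ n) := by
    rw [← lintegral_slice_eq_Ioo hX hfpos hf0 (φ := fun s => (1 + R) ^ (n + 1)) (by fun_prop)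
      fun s hs => by positivity]
    simp
  rw [hVX, volume_eq_lintegral_slice hZc.measurableSet]
  rw [hXe, hKe] at hle
  rw [hKe] at hfin
  refine lintegral_slices_le hab hce hfc (fun s hs => volRadius_pos (hX.slice s) (hfpos s hs)) hgc
    (fun s hs => volRadius_pos (hK.slice s) (hgpos s hs)) h1' h2' h3' hle hfin ?_
  intro s hs τ hτ
  -- All points of `K` over `τ` scale by the same factor `1 + ω τ`, so the slices combine by an
  -- ordinary Minkowski sum in dimension `n`.
  have h := hBM.smul_add_smul (hX.slice s) (hXc.slice s) (hK.slice τ) (hKc.slice τ)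
    (hfpos s hs) (hgpos τ hτ) (h2' τ hτ) one_pos
  rw [one_mul] at h
  refine h.trans (measure_mono ?_)
  rintro _ ⟨_, ⟨x, hx, rfl⟩, _, ⟨y, hy, rfl⟩, rfl⟩
  change (Fin.cons (s + τ * (1 + ω * s)) ((1 + ω * τ) • x + (1 : ℝ) • y) : Fin (n + 1) → ℝ) ∈ Z
  refine ⟨_, hx, _, hy, ?_⟩
  have := finCons_combo (1 + ω * τ) 1 s τ x y
  rw [show s + τ * (1 + ω * s) = (1 + ω * τ) * s + 1 * τ by ring, this]
  simp

open scoped Pointwise in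
/-- The Brunn-Minkowski inequality, proved slice by slice by induction on the dimension. -/
theorem brunnMinkowski (n : ℕ) : BrunnMinkowski n := by
  induction n with
  | zero =>
    intro X K _ _ _ _ p q _ _ hXv hKv
    have hne : ∀ S : Set (Fin 0 → ℝ), ENNReal.ofReal 1 ≤ volume S → S.Nonempty := fun S hS =>
      nonempty_of_measure_ne_zero (ne_of_gt (lt_of_lt_of_le (by simp) hS))
    have : (X + K) = univ :=
      Subsingleton.eq_univ_of_nonempty ((hne X (by simpa using hXv)).add (hne K (by simpa using hKv)))
    rw [this]; simp [volume_pi]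
  | succ n ih =>
    intro X K hX hXc hK hKc p q hp hq hXv hKv
    have hX0 : 0 < volume X := lt_of_lt_of_le (by simp; positivity) hXv
    have hK0 : 0 < volume K := lt_of_lt_of_le (by simp; positivity) hKv
    have hP := volRadius_pos hX hX0
    have hQ := volRadius_pos hK hK0
    set P := volRadius X with hPdef
    set Q := volRadius K with hQdef
    have hpP : p ≤ P := le_volRadius (by omega) hX hp.le hXv
    have hqQ : q ≤ Q := le_volRadius (by omega) hK hq.le hKv
    have hVX := volume_eq_volRadius_pow hX hX0
    have hVK := volume_eq_volRadius_pow hK hK0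
    rw [← hPdef] at hVX
    rw [← hQdef] at hVK
    -- For `ω = 0` the action is translation, and `R = Q / P` turns the integral hypothesis into an
    -- equality.
    have h := ih.le_volume_image2 hX hXc hX0 hK hKc hK0 (ω := 0) (R := Q / P)
      (by simp) (by simp) (fun y _ => by simp; positivity) (by
        simp only [zero_mul, add_zero, sub_zero, lintegral_const, Measure.restrict_apply_univ]
        rw [hVX, hVK, ← ENNReal.ofReal_mul (by positivity), ← ENNReal.ofReal_mul (by positivity)]
        apply ENNReal.ofReal_le_ofReal
        rw [div_pow]
        field_simp
        exact le_rfl)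
    calc ENNReal.ofReal ((p + q) ^ (n + 1)) ≤ ENNReal.ofReal ((P + Q) ^ (n + 1)) := by
          gcongr
      _ = ENNReal.ofReal ((1 + Q / P) ^ (n + 1)) * volume X := by
          rw [hVX, ← ENNReal.ofReal_mul (by positivity), ← mul_pow]
          congr 2
          field_simp
      _ ≤ _ := h
      _ ≤ _ := by
          refine measure_mono ?_
          rintro _ ⟨x, hx, y, hy, rfl⟩
          simp only [zero_mul, add_zero, one_smul]
          exact Set.add_mem_add hx hy

/-! ### Coordinate-free form and polar coordinates. -/

/-- Orthonormal coordinates whose first axis points in a given direction. -/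
lemma exists_coordinates_inner {n : ℕ} (w : EuclideanSpace ℝ (Fin (n + 1))) :
    ∃ (ω : ℝ) (Φ : EuclideanSpace ℝ (Fin (n + 1)) ≃L[ℝ] (Fin (n + 1) → ℝ)),
      MeasurePreserving Φ ∧ ∀ x, inner ℝ w x = ω * Φ x 0 := by
  have hb : ∃ b : OrthonormalBasis (Fin (n + 1)) ℝ (EuclideanSpace ℝ (Fin (n + 1))),
      w = ‖w‖ • b 0 := by
    rcases eq_or_ne w 0 with rfl | hw
    · exact ⟨EuclideanSpace.basisFun _ _, by simp⟩
    · obtain ⟨b, hb⟩ := Orthonormal.exists_orthonormalBasis_extension_of_card_eq (𝕜 := ℝ)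
        (E := EuclideanSpace ℝ (Fin (n + 1))) (ι := Fin (n + 1)) (by simp)
        (v := fun _ => ‖w‖⁻¹ • w) (s := {0}) (by
          rw [orthonormal_iff_ite]
          intro i j
          have hij : i = j := Subsingleton.elim _ _
          have hn : ‖w‖ ≠ 0 := norm_ne_zero_iff.2 hw
          simp only [domRestrict_apply, hij, if_true, real_inner_self_eq_norm_sq, norm_smul, norm_inv,
            norm_norm]
          field_simp)
      refine ⟨b, ?_⟩
      rw [hb 0 rfl, smul_inv_smul₀ (norm_ne_zero_iff.2 hw)]
  obtain ⟨b, hb⟩ := hb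
  refine ⟨‖w‖, b.repr.toContinuousLinearEquiv.trans (EuclideanSpace.equiv (Fin (n + 1)) ℝ),
    (PiLp.volume_preserving_ofLp (Fin (n + 1))).comp b.repr.measurePreserving, fun x => ?_⟩
  have : inner ℝ w x = ‖w‖ * inner ℝ (b 0) x := by
    conv_lhs => rw [hb]
    rw [real_inner_smul_left]
  rw [this, ← b.repr_apply_apply]
  rfl

/-- Coordinate-free form of `BrunnMinkowski.le_volume_image2`. -/
theorem le_volume_image2_inner {n : ℕ} {X K : Set (EuclideanSpace ℝ (Fin (n + 1)))}
    (hX : IsCompact X) (hXc : Convex ℝ X) (hX0 : 0 < volume X)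
    (hK : IsCompact K) (hKc : Convex ℝ K) (hK0 : 0 < volume K)
    {w : EuclideanSpace ℝ (Fin (n + 1))} {R : ℝ}
    (h1 : ∀ x ∈ X, 0 < 1 + inner ℝ w x) (h2 : ∀ y ∈ K, 0 < 1 + inner ℝ w y)
    (h3 : ∀ y ∈ K, 0 < R - inner ℝ w y)
    (hle : ∫⁻ x in X, ENNReal.ofReal (1 / (1 + inner ℝ w x)) ≤
      ∫⁻ y in K, ENNReal.ofReal (1 / (R - inner ℝ w y) ^ (n + 1))) :
    ENNReal.ofReal ((1 + R) ^ (n + 1)) * volume X ≤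
      volume (image2 (fun x y => (1 + inner ℝ w y) • x + y) X K) := by
  obtain ⟨ω, Φ, hΦ, hw⟩ := exists_coordinates_inner w
  have hemb : MeasurableEmbedding Φ := Φ.toHomeomorph.measurableEmbedding
  have hvol : ∀ S, volume (Φ '' S) = volume S := fun S => by
    rw [← hΦ.measure_preimage_emb hemb, preimage_image_eq _ Φ.injective]
  have himg : Φ '' (image2 (fun x y => (1 + inner ℝ w y) • x + y) X K) =
      image2 (fun x y => (1 + ω * y 0) • x + y) (Φ '' X) (Φ '' K) := by
    rw [image_image2, image2_image_left, image2_image_right]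
    simp [hw]
  have h := (brunnMinkowski n).le_volume_image2 (X := Φ '' X) (K := Φ '' K) (ω := ω) (R := R)
    (hX.image Φ.continuous) (hXc.is_linear_image Φ.toLinearMap.isLinear) (by rwa [hvol])
    (hK.image Φ.continuous) (hKc.is_linear_image Φ.toLinearMap.isLinear) (by rwa [hvol])
    (by rintro _ ⟨x, hx, rfl⟩; rw [← hw]; exact h1 x hx)
    (by rintro _ ⟨x, hx, rfl⟩; rw [← hw]; exact h2 x hx)
    (by rintro _ ⟨x, hx, rfl⟩; rw [← hw]; exact h3 x hx)
    (by
      rw [← hΦ.setLIntegral_comp_emb hemb, ← hΦ.setLIntegral_comp_emb hemb]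
      simpa only [hw] using hle)
  rwa [← himg, hvol, hvol] at h

/-- Integration in polar coordinates bounds the volume of a set by its radial function. -/
lemma volume_le_lintegral_toSphere {n : ℕ} {Z : Set (EuclideanSpace ℝ (Fin (n + 1)))}
    {ρ : Metric.sphere (0 : EuclideanSpace ℝ (Fin (n + 1))) 1 → ℝ} (hρ : Continuous ρ)
    (hpos : ∀ v, 0 < ρ v)
    (hZ : ∀ v : Metric.sphere (0 : EuclideanSpace ℝ (Fin (n + 1))) 1, ∀ r : ℝ, 0 < r →
      r • (v : EuclideanSpace ℝ (Fin (n + 1))) ∈ Z → r < ρ v) :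
    volume Z ≤ ∫⁻ v, ENNReal.ofReal (ρ v ^ (n + 1) / (n + 1))
      ∂(volume : Measure (EuclideanSpace ℝ (Fin (n + 1)))).toSphere := by
  set A : Set (Metric.sphere (0 : EuclideanSpace ℝ (Fin (n + 1))) 1 × Ioi (0 : ℝ)) :=
    {p | (p.2 : ℝ) < ρ p.1} with hA
  set H := homeomorphUnitSphereProd (EuclideanSpace ℝ (Fin (n + 1))) with hH
  have hAm : MeasurableSet A :=
    (isOpen_lt (by fun_prop) (by fun_prop)).measurableSet
  have hmp :=
    (volume : Measure (EuclideanSpace ℝ (Fin (n + 1)))).measurePreserving_homeomorphUnitSphereProd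
  have hsub : Z ⊆ {0} ∪ Subtype.val '' (H ⁻¹' A) := by
    intro z hz
    rcases eq_or_ne z 0 with h0 | h0
    · exact Or.inl h0
    · refine Or.inr ⟨⟨z, h0⟩, ?_, rfl⟩
      change ((H ⟨z, h0⟩).2 : ℝ) < ρ (H ⟨z, h0⟩).1
      refine hZ _ _ (H ⟨z, h0⟩).2.2 ?_
      rw [homeomorphUnitSphereProd_apply_snd_coe, homeomorphUnitSphereProd_apply_fst_coe,
        smul_inv_smul₀ (norm_ne_zero_iff.2 h0)]
      exact hz
  have hdim : Module.finrank ℝ (EuclideanSpace ℝ (Fin (n + 1))) - 1 = n := by simp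
  calc volume Z ≤ volume ({0} : Set (EuclideanSpace ℝ (Fin (n + 1)))) +
        volume (Subtype.val '' (H ⁻¹' A)) :=
      (measure_mono hsub).trans (measure_union_le _ _)
    _ = (volume : Measure (EuclideanSpace ℝ (Fin (n + 1)))).toSphere.prod
        (Measure.volumeIoiPow (Module.finrank ℝ (EuclideanSpace ℝ (Fin (n + 1))) - 1)) A := by
      rw [measure_singleton, zero_add, ← hmp.measure_preimage hAm.nullMeasurableSet,
        comap_subtype_coe_apply (measurableSet_singleton _).compl]
    _ = ∫⁻ v, ENNReal.ofReal (ρ v ^ (n + 1) / (n + 1))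
        ∂(volume : Measure (EuclideanSpace ℝ (Fin (n + 1)))).toSphere := by
      rw [Measure.prod_apply hAm]
      refine lintegral_congr fun v => ?_
      rw [hdim]
      exact Measure.volumeIoiPow_apply_Iio n ⟨ρ v, hpos v⟩

/-! ### Support functions. -/

section SupportFunction

variable {F : Type*} [NormedAddCommGroup F] [InnerProductSpace ℝ F]

/-- The support function of a set. -/
noncomputable def supportFn (S : Set F) (z : F) : ℝ :=
  sSup ((fun x => inner ℝ x z) '' S)

lemma bddAbove_inner_image {S : Set F} (hS : S ⊆ Metric.closedBall 0 1) (z : F) :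
    BddAbove ((fun x => inner ℝ x z) '' S) := by
  refine ⟨‖z‖, ?_⟩
  rintro _ ⟨x, hx, rfl⟩
  have h1 : ‖x‖ ≤ 1 := by simpa using hS hx
  calc inner ℝ x z ≤ ‖x‖ * ‖z‖ := real_inner_le_norm x z
    _ ≤ 1 * ‖z‖ := by gcongr
    _ = ‖z‖ := one_mul _

lemma inner_le_supportFn {S : Set F} (hS : S ⊆ Metric.closedBall 0 1) {x : F} (hx : x ∈ S)
    (z : F) : inner ℝ x z ≤ supportFn S z :=
  le_csSup (bddAbove_inner_image hS z) ⟨x, hx, rfl⟩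

/-- Half-spaces are closed and convex. Hence an arbitrary code cell may be replaced by its closed
convex hull, to which Brunn-Minkowski applies. -/
lemma inner_le_supportFn_of_mem_closure {S : Set F} (hS : S ⊆ Metric.closedBall 0 1) {y : F}
    (hy : y ∈ closure (convexHull ℝ S)) (z : F) : inner ℝ y z ≤ supportFn S z := by
  have hcl : IsClosed {y : F | inner ℝ y z ≤ supportFn S z} :=
    isClosed_le (by fun_prop) continuous_const
  have hconv : Convex ℝ {y : F | inner ℝ y z ≤ supportFn S z} := by
    refine convex_halfSpace_le ⟨fun x y => inner_add_left x y z, fun c x => ?_⟩ _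
    simp [real_inner_smul_left]
  exact closure_minimal (convexHull_min (fun x hx => inner_le_supportFn hS hx z) hconv) hcl hy

lemma supportFn_le_add {S : Set F} (hS : S ⊆ Metric.closedBall 0 1) (hne : S.Nonempty) (z z' : F) :
    supportFn S z ≤ supportFn S z' + ‖z - z'‖ := by
  refine csSup_le (hne.image _) ?_
  rintro _ ⟨x, hx, rfl⟩
  have h1 : ‖x‖ ≤ 1 := by simpa using hS hx
  have h2 : inner ℝ x (z - z') ≤ ‖z - z'‖ :=
    calc inner ℝ x (z - z') ≤ ‖x‖ * ‖z - z'‖ := real_inner_le_norm _ _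
      _ ≤ 1 * ‖z - z'‖ := by gcongr
      _ = ‖z - z'‖ := one_mul _
  rw [inner_sub_right] at h2
  have := inner_le_supportFn hS hx z'
  simp only
  linarith

lemma continuous_supportFn {S : Set F} (hS : S ⊆ Metric.closedBall 0 1) (hne : S.Nonempty) :
    Continuous (supportFn S) := by
  refine (LipschitzWith.of_le_add fun z z' => ?_ : LipschitzWith 1 (supportFn S)).continuous
  rw [dist_eq_norm]
  exact supportFn_le_add hS hne z z'

lemma abs_supportFn_le {S : Set F} (hS : S ⊆ Metric.closedBall 0 1) (hne : S.Nonempty) (z : F) :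
    |supportFn S z| ≤ ‖z‖ := by
  have h0 : supportFn S 0 = 0 := by
    simp [supportFn, inner_zero_right, hne.image_const]
  have h1 := supportFn_le_add hS hne z 0
  have h2 := supportFn_le_add hS hne 0 z
  rw [h0] at h1 h2
  simp only [sub_zero, zero_sub, norm_neg] at h1 h2
  rw [abs_le]
  constructor <;> linarith

end SupportFunction

/-! ### The Urysohn type inequality. -/

/-- A converse to Bernoulli's inequality. Only the first order in `a` matters later, so the constant
of the quadratic error may be crude. -/
lemma one_add_pow_le {a : ℝ} (h1 : -1 ≤ a) (h2 : a ≤ 1) (n : ℕ) :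
    (1 + a) ^ n ≤ 1 + n * a + 3 ^ n * a ^ 2 := by
  induction n with
  | zero => simp; positivity
  | succ n ih =>
    have hn : (n : ℝ) ≤ 3 ^ n := by exact_mod_cast (Nat.lt_pow_self (by norm_num : 1 < 3)).le
    have h3 : (0 : ℝ) < 3 ^ n := by positivity
    calc (1 + a) ^ (n + 1) = (1 + a) ^ n * (1 + a) := pow_succ _ _
      _ ≤ (1 + n * a + 3 ^ n * a ^ 2) * (1 + a) := by
        apply mul_le_mul_of_nonneg_right ih; linarith
      _ ≤ _ := by
        push_cast
        have h4 : 0 ≤ (3 ^ n - n : ℝ) * a ^ 2 := mul_nonneg (by linarith) (sq_nonneg a)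
        have h5 : 0 ≤ 3 ^ n * (1 - a) * a ^ 2 :=
          mul_nonneg (mul_nonneg h3.le (by linarith)) (sq_nonneg a)
        rw [pow_succ (3 : ℝ)]
        nlinarith

/-- Scaling of the weighted volume. -/
lemma setLIntegral_smul_image {n : ℕ} {K : Set (EuclideanSpace ℝ (Fin (n + 1)))} {t : ℝ}
    (ht : 0 < t) (w : EuclideanSpace ℝ (Fin (n + 1))) (r : ℝ)
    (hr : ∀ y ∈ K, 0 < r - inner ℝ w y) (hK : MeasurableSet K) :
    ∫⁻ y in (fun x => t • x) '' K, ENNReal.ofReal (1 / (t * r - inner ℝ w y) ^ (n + 1)) =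
      ∫⁻ y in K, ENNReal.ofReal (1 / (r - inner ℝ w y) ^ (n + 1)) := by
  have hemb : MeasurableEmbedding fun x : EuclideanSpace ℝ (Fin (n + 1)) => t • x :=
    (Homeomorph.smulOfNeZero t ht.ne').measurableEmbedding
  have hmap := Measure.map_addHaar_smul (volume : Measure (EuclideanSpace ℝ (Fin (n + 1)))) ht.ne'
  -- The weight is homogeneous of degree `-(n + 1)` in `(r, y)` jointly, which cancels the Jacobian
  -- `t ^ (n + 1)`.
  have hvol : (volume : Measure (EuclideanSpace ℝ (Fin (n + 1)))) =
      ENNReal.ofReal (t ^ (n + 1)) • Measure.map (fun x => t • x) volume := by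
    rw [hmap, smul_smul, ← ENNReal.ofReal_mul (by positivity)]
    simp only [finrank_euclideanSpace, Fintype.card_fin]
    rw [abs_of_pos (by positivity), mul_inv_cancel₀ (by positivity)]
    simp
  conv_lhs => rw [hvol]
  rw [Measure.restrict_smul, lintegral_smul_measure, hemb.restrict_map, hemb.lintegral_map,
    hemb.injective.preimage_image, smul_eq_mul, ← lintegral_const_mul' _ _ ENNReal.ofReal_ne_top]
  refine setLIntegral_congr_fun hK fun y hy => ?_
  have := hr y hy
  rw [← ENNReal.ofReal_mul (by positivity), real_inner_smul_right, ← mul_sub, mul_pow]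
  congr 1
  field_simp

/-- A Urysohn type inequality for the mean of the support function of a set over a translate of
the sphere. -/
theorem le_integral_supportFn {n : ℕ} {S : Set (EuclideanSpace ℝ (Fin (n + 1)))}
    (hS : S ⊆ Metric.closedBall 0 1) {w : EuclideanSpace ℝ (Fin (n + 1))} {r : ℝ} (hwr : ‖w‖ < r)
    (hr1 : r ≤ 1)
    (hle : ∫⁻ x in Metric.closedBall (0 : EuclideanSpace ℝ (Fin (n + 1))) 1,
        ENNReal.ofReal (1 / (1 + inner ℝ w x)) ≤
      ∫⁻ y in closure (convexHull ℝ S), ENNReal.ofReal (1 / (r - inner ℝ w y) ^ (n + 1))) :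
    S.Nonempty ∧
    r * (volume : Measure (EuclideanSpace ℝ (Fin (n + 1)))).toSphere.real univ ≤
      ∫ v : Metric.sphere (0 : EuclideanSpace ℝ (Fin (n + 1))) 1, supportFn S (w + v)
        ∂(volume : Measure (EuclideanSpace ℝ (Fin (n + 1)))).toSphere := by
  set σ := (volume : Measure (EuclideanSpace ℝ (Fin (n + 1)))).toSphere with hσ
  set X := Metric.closedBall (0 : EuclideanSpace ℝ (Fin (n + 1))) 1 with hX
  set K := closure (convexHull ℝ S) with hK
  have hr0 : 0 < r := (norm_nonneg w).trans_lt hwr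
  have hKX : K ⊆ X := closure_minimal (convexHull_min hS (convex_closedBall _ _))
    Metric.isClosed_closedBall
  have hXcpt : IsCompact X := isCompact_closedBall _ _
  have hKcpt : IsCompact K := hXcpt.of_isClosed_subset isClosed_closure hKX
  have hKconv : Convex ℝ K := (convex_convexHull ℝ S).closure
  have hX0 : 0 < volume X :=
    Metric.measure_closedBall_pos _ _ one_pos
  have hinner : ∀ x ∈ X, |inner ℝ w x| ≤ ‖w‖ := fun x hx => by
    have h1 : ‖x‖ ≤ 1 := by simpa [hX] using hx
    calc |inner ℝ w x| ≤ ‖w‖ * ‖x‖ := abs_real_inner_le_norm _ _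
      _ ≤ ‖w‖ * 1 := by gcongr
      _ = ‖w‖ := mul_one _
  have hXpos : ∀ x ∈ X, 0 < 1 + inner ℝ w x := fun x hx => by
    have := (abs_le.1 (hinner x hx)).1; linarith
  have hKpos : ∀ x ∈ K, 0 < r - inner ℝ w x := fun x hx => by
    have := (abs_le.1 (hinner x (hKX hx))).2; linarith
  have hK0 : 0 < volume K := by
    rw [pos_iff_ne_zero]
    intro h0
    rw [setLIntegral_measure_zero _ _ h0, nonpos_iff_eq_zero, setLIntegral_eq_zero_iff
      hXcpt.measurableSet (by fun_prop)] at hle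
    have : volume X = 0 := by
      refine measure_mono_null ?_ (ae_iff.1 hle)
      intro x hx
      simp only [mem_ofPred_eq, Classical.not_imp]
      refine ⟨hx, ?_⟩
      have := hXpos x hx
      simp only [ENNReal.ofReal_eq_zero, not_le]
      positivity
    exact hX0.ne' this
  have hne : S.Nonempty := by
    have := nonempty_of_measure_ne_zero hK0.ne'
    rwa [hK, closure_nonempty_iff, convexHull_nonempty_iff] at this
  refine ⟨hne, ?_⟩
  set h : Metric.sphere (0 : EuclideanSpace ℝ (Fin (n + 1))) 1 → ℝ :=
    fun v => supportFn S (w + v) with hh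
  have hhc : Continuous h := (continuous_supportFn hS hne).comp (by fun_prop)
  have hint : ∀ f : Metric.sphere (0 : EuclideanSpace ℝ (Fin (n + 1))) 1 → ℝ, Continuous f →
      Integrable f σ := fun f hf =>
    hf.integrable_of_hasCompactSupport (HasCompactSupport.of_compactSpace f)
  have hhb : ∀ v, |h v| ≤ 2 := fun v => by
    have hv : ‖(v : EuclideanSpace ℝ (Fin (n + 1)))‖ = 1 := by simp
    calc |h v| ≤ ‖w + v‖ := abs_supportFn_le hS hne _
      _ ≤ ‖w‖ + ‖(v : EuclideanSpace ℝ (Fin (n + 1)))‖ := norm_add_le _ _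
      _ ≤ 2 := by linarith
  have hσX : σ.real univ = (n + 1) * (volume X).toReal := by
    rw [hσ, Measure.toSphere_real_apply_univ, hX, Measure.addHaar_closedBall_eq_addHaar_ball]
    simp [measureReal_def]
  have hd : (0 : ℝ) < n + 1 := by positivity
  -- Both bounds for the volume of the deformed sum of the ball and `t K`. As `|h| ≤ 2`, the
  -- restriction `t < 1 / 3` keeps the radial bound positive; its extra `t ^ 2` makes the radial
  -- inequality strict and vanishes to first order.
  have key : ∀ t : ℝ, 0 < t → t < 1 / 3 →
      (1 + t * r) ^ (n + 1) * σ.real univ ≤ ∫ v, (1 + t * (h v + t)) ^ (n + 1) ∂σ := by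
    intro t ht0 ht1
    have hbase : ∀ v, 0 < 1 + t * (h v + t) := fun v => by
      have := (abs_le.1 (hhb v)).1
      nlinarith
    have hlow := le_volume_image2_inner (K := (fun x => t • x) '' K) (w := w) (R := t * r)
      hXcpt (convex_closedBall _ _) hX0 (hKcpt.image (by fun_prop)) (hKconv.smul t)
      (by
        have := Measure.addHaar_smul_of_nonneg
          (volume : Measure (EuclideanSpace ℝ (Fin (n + 1)))) ht0.le K
        rw [← image_smul] at this
        rw [this]
        exact ENNReal.mul_pos (by simp; positivity) hK0.ne')
      hXpos
      (by
        rintro _ ⟨y, hy, rfl⟩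
        have := (abs_le.1 (hinner y (hKX hy))).1
        rw [real_inner_smul_right]
        nlinarith [norm_nonneg w])
      (by
        rintro _ ⟨y, hy, rfl⟩
        have := hKpos y hy
        rw [real_inner_smul_right, ← mul_sub]
        positivity)
      (by rwa [setLIntegral_smul_image ht0 w r hKpos hKcpt.measurableSet])
    have hup := volume_le_lintegral_toSphere
      (Z := image2 (fun x y => (1 + inner ℝ w y) • x + y) X ((fun x => t • x) '' K))
      (ρ := fun v => 1 + t * (h v + t)) (by fun_prop) hbase (by
        rintro v ρ hρ ⟨x, hx, _, ⟨y, hy, rfl⟩, hz⟩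
        have hv : ‖(v : EuclideanSpace ℝ (Fin (n + 1)))‖ = 1 := by simp
        have h1 : ρ = inner ℝ (ρ • (v : EuclideanSpace ℝ (Fin (n + 1)))) v := by
          rw [real_inner_smul_left, real_inner_self_eq_norm_sq, hv]; ring
        simp only at hz
        rw [← hz, inner_add_left, real_inner_smul_left, real_inner_smul_left,
          real_inner_smul_right] at h1
        have hx1 : ‖x‖ ≤ 1 := by simpa [hX] using hx
        have h2 : inner ℝ x (v : EuclideanSpace ℝ (Fin (n + 1))) ≤ 1 := by
          have := real_inner_le_norm x (v : EuclideanSpace ℝ (Fin (n + 1)))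
          rw [hv, mul_one] at this
          linarith
        have h3 : 0 < 1 + t * inner ℝ w y := by
          have := (abs_le.1 (hinner y (hKX hy))).1
          nlinarith [norm_nonneg w]
        have h4 : inner ℝ y (w + v) ≤ h v := inner_le_supportFn_of_mem_closure hS hy _
        rw [inner_add_right, real_inner_comm] at h4
        have h5 : (1 + t * inner ℝ w y) * inner ℝ x (v : EuclideanSpace ℝ (Fin (n + 1))) ≤
          (1 + t * inner ℝ w y) * 1 := mul_le_mul_of_nonneg_left h2 h3.le
        rw [h1]
        nlinarith)
    have h6 := hlow.trans hup
    have hc : Continuous fun v => (1 + t * (h v + t)) ^ (n + 1) / ((n : ℝ) + 1) := by fun_prop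
    rw [← ofReal_integral_eq_lintegral_ofReal (hint _ hc)
      (Filter.Eventually.of_forall fun v => by have := hbase v; positivity),
      ← ENNReal.ofReal_toReal hXcpt.measure_lt_top.ne, ← ENNReal.ofReal_mul (by positivity),
      ENNReal.ofReal_le_ofReal_iff (integral_nonneg fun v => by have := hbase v; positivity),
      integral_div, le_div_iff₀ hd] at h6
    rw [hσX]
    linarith
  have key2 : ∀ t : ℝ, 0 < t → t < 1 / 3 →
      r * σ.real univ ≤ ∫ v, h v ∂σ + t * (σ.real univ * (1 + 9 * 3 ^ (n + 1) / (n + 1))) := by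
    intro t ht0 ht1
    have hσ0 : 0 ≤ σ.real univ := measureReal_nonneg
    have h1 : (1 + (n + 1) * (t * r)) ≤ (1 + t * r) ^ (n + 1) := by
      have := one_add_mul_le_pow (a := t * r) (by nlinarith) (n + 1)
      push_cast at this
      exact this
    have h2 : ∫ v, (1 + t * (h v + t)) ^ (n + 1) ∂σ ≤
        ∫ v, (1 + (n + 1) * t ^ 2 + 3 ^ (n + 1) * (9 * t ^ 2) + (n + 1) * t * h v) ∂σ := by
      refine integral_mono (hint _ (by fun_prop)) (hint _ (by fun_prop)) fun v => ?_
      obtain ⟨hv1, hv2⟩ := abs_le.1 (hhb v)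
      have := one_add_pow_le (a := t * (h v + t)) (by nlinarith) (by nlinarith) (n + 1)
      push_cast at this
      have hsq : (t * (h v + t)) ^ 2 ≤ 9 * t ^ 2 := by
        rw [mul_pow]
        have : (h v + t) ^ 2 ≤ 9 := by nlinarith
        nlinarith [sq_nonneg t]
      have h3 : (3 : ℝ) ^ (n + 1) * (t * (h v + t)) ^ 2 ≤ 3 ^ (n + 1) * (9 * t ^ 2) := by gcongr
      simp only
      nlinarith
    rw [integral_add (hint _ (by fun_prop)) (hint _ (by fun_prop)), integral_const,
      integral_const_mul, smul_eq_mul] at h2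
    have h3 := (mul_le_mul_of_nonneg_right h1 hσ0).trans ((key t ht0 ht1).trans h2)
    have h4 : (n + 1) * t * (r * σ.real univ) ≤
        (n + 1) * t * (∫ v, h v ∂σ + t * (σ.real univ * (1 + 9 * 3 ^ (n + 1) / (n + 1)))) := by
      have e : (n + 1) * t * (∫ v, h v ∂σ + t * (σ.real univ * (1 + 9 * 3 ^ (n + 1) / (n + 1)))) =
        (n + 1) * t * ∫ v, h v ∂σ + σ.real univ * ((n + 1) * t ^ 2 + 3 ^ (n + 1) * (9 * t ^ 2)) := by
        field_simp
      rw [e]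
      nlinarith
    exact le_of_mul_le_mul_left h4 (by positivity)
  -- After division by `(n + 1) t` the error is `t M`, which disappears as `t → 0`.
  set M := σ.real univ * (1 + 9 * 3 ^ (n + 1) / (n + 1)) with hM
  have hlim : Filter.Tendsto (fun t : ℝ => ∫ v, h v ∂σ + t * M) (nhdsWithin 0 (Ioi 0))
      (nhds (∫ v, h v ∂σ + 0 * M)) :=
    Filter.Tendsto.mono_left (Continuous.tendsto (by fun_prop) 0) nhdsWithin_le_nhds
  rw [zero_mul, add_zero] at hlim
  refine ge_of_tendsto hlim ?_
  filter_upwards [Ioo_mem_nhdsGT (show (0 : ℝ) < 1 / 3 by norm_num)] with t ht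
  exact key2 t ht.1 ht.2

/-! ### Symmetrisation and the pigeonhole over the cells. -/

lemma setLIntegral_closedBall_neg {n : ℕ} (f : EuclideanSpace ℝ (Fin n) → ENNReal) :
    ∫⁻ x in Metric.closedBall (0 : EuclideanSpace ℝ (Fin n)) 1, f (-x) =
      ∫⁻ x in Metric.closedBall (0 : EuclideanSpace ℝ (Fin n)) 1, f x := by
  have h := (Measure.measurePreserving_neg
    (volume : Measure (EuclideanSpace ℝ (Fin n)))).setLIntegral_comp_preimage_emb
      (Homeomorph.neg _).measurableEmbedding f (Metric.closedBall 0 1)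
  have hpre : Neg.neg ⁻¹' Metric.closedBall (0 : EuclideanSpace ℝ (Fin n)) 1 =
      Metric.closedBall 0 1 := by
    ext x; simp
  rwa [hpre] at h

/-- The surface measure is, up to a factor, the volume of cones, and Lebesgue measure is invariant
under `x ↦ -x`. -/
lemma measurePreserving_neg_toSphere {n : ℕ} :
    MeasurePreserving (fun v : Metric.sphere (0 : EuclideanSpace ℝ (Fin n)) 1 => -v)
      (volume : Measure (EuclideanSpace ℝ (Fin n))).toSphere
      (volume : Measure (EuclideanSpace ℝ (Fin n))).toSphere := by
  have hc : Measurable (fun v : Metric.sphere (0 : EuclideanSpace ℝ (Fin n)) 1 => -v) :=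
    continuous_neg.measurable
  refine ⟨hc, Measure.ext fun s hs => ?_⟩
  rw [Measure.map_apply hc hs, Measure.toSphere_apply' _ hs, Measure.toSphere_apply' _ (hc hs)]
  congr 1
  rw [← Measure.measure_neg (μ := volume)]
  congr 1
  ext x
  simp only [mem_neg, mem_smul, mem_image, mem_preimage]
  constructor
  · rintro ⟨a, ha, _, ⟨v, hv, rfl⟩, hx⟩
    exact ⟨a, ha, _, ⟨-v, hv, rfl⟩, by simp [hx]⟩
  · rintro ⟨a, ha, _, ⟨v, hv, rfl⟩, hx⟩
    exact ⟨a, ha, _, ⟨-v, by simpa using hv, rfl⟩, by simp [hx]⟩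

lemma integral_inner_toSphere {n : ℕ} (x : EuclideanSpace ℝ (Fin n)) :
    ∫ v : Metric.sphere (0 : EuclideanSpace ℝ (Fin n)) 1, inner ℝ x (v : EuclideanSpace ℝ (Fin n))
      ∂(volume : Measure (EuclideanSpace ℝ (Fin n))).toSphere = 0 := by
  have h := (measurePreserving_neg_toSphere (n := n)).integral_comp
    (Homeomorph.neg _).measurableEmbedding
    fun v : Metric.sphere (0 : EuclideanSpace ℝ (Fin n)) 1 =>
      inner ℝ x (v : EuclideanSpace ℝ (Fin n))
  simp only [coe_neg_sphere, inner_neg_right, integral_neg] at h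
  linarith

/-- The pointwise comparison of the two weights at `s = ⟪w, x⟫`, symmetrised in `s`. With `p = r /
(r - s)` and `q = r / (r + s)`, Bernoulli and `p + q ≥ 2` give `p ^ d + q ^ d ≥ p + q = 2 / (1 - s²
/ r²)`, and `r ≤ 1` does the rest. -/
lemma card_mul_le_inv_pow_add {N s r : ℝ} {d : ℕ} (hd : 1 ≤ d) (hs : |s| < r)
    (hr1 : r ≤ 1) (hNr : N * r ^ d ≤ 1) :
    N * (1 / (1 + s) + 1 / (1 - s)) ≤ 1 / (r - s) ^ d + 1 / (r + s) ^ d := by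
  have hr0 : 0 < r := (abs_nonneg s).trans_lt hs
  obtain ⟨hs1, hs2⟩ := abs_lt.1 hs
  have ha : s ^ 2 < r ^ 2 := sq_lt_sq' hs1 hs2
  have hr2 : r ^ 2 ≤ 1 := by nlinarith
  have h1 : 0 < r - s := by linarith
  have h2 : 0 < r + s := by linarith
  have h3 : 0 < 1 - s := by linarith
  have h4 : 0 < 1 + s := by linarith
  set p := r / (r - s) with hp
  set q := r / (r + s) with hq
  have hp0 : 0 < p := div_pos hr0 h1
  have hq0 : 0 < q := div_pos hr0 h2
  have hdR : (1 : ℝ) ≤ d := by exact_mod_cast hd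
  have hpq : p + q = 2 * r ^ 2 / (r ^ 2 - s ^ 2) := by
    have : r ^ 2 - s ^ 2 ≠ 0 := by nlinarith
    rw [hp, hq, show r ^ 2 - s ^ 2 = (r - s) * (r + s) by ring]
    field_simp
    ring
  have hab : 1 / (1 + s) + 1 / (1 - s) = 2 / (1 - s ^ 2) := by
    rw [show 1 - s ^ 2 = (1 - s) * (1 + s) by ring]
    field_simp
    ring
  have hle1 : 2 / (1 - s ^ 2) ≤ p + q := by
    rw [hpq, div_le_div_iff₀ (by linarith) (by linarith)]
    nlinarith [sq_nonneg s, mul_nonneg (sq_nonneg s) (by linarith : 0 ≤ 1 - r ^ 2)]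
  have hge2 : 2 ≤ p + q := by
    rw [hpq, le_div_iff₀ (by linarith)]
    nlinarith [sq_nonneg s]
  have hbp := one_add_mul_le_pow (a := p - 1) (by linarith) d
  have hbq := one_add_mul_le_pow (a := q - 1) (by linarith) d
  rw [add_sub_cancel] at hbp hbq
  have hsum : p + q ≤ p ^ d + q ^ d := by nlinarith
  have hrd : 0 < r ^ d := pow_pos hr0 d
  have hNle : N ≤ 1 / r ^ d := by rwa [le_div_iff₀ hrd]
  calc N * (1 / (1 + s) + 1 / (1 - s)) ≤ 1 / r ^ d * (p ^ d + q ^ d) := by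
        rw [hab]
        exact mul_le_mul hNle (hle1.trans hsum) (div_nonneg zero_le_two (by linarith))
          (by positivity)
    _ = _ := by
        rw [hp, hq, div_pow, div_pow]
        field_simp

/-- Every covering of the unit ball by few cells has, for every `w`, a cell whose support function
has a large mean over the unit sphere around `w`. -/
theorem exists_cell_le_integral_supportFn {n : ℕ} {ι : Type*} [Fintype ι]
    {S : ι → Set (EuclideanSpace ℝ (Fin (n + 1)))} (hS : ∀ c, S c ⊆ Metric.closedBall 0 1)
    (hcov : Metric.closedBall 0 1 ⊆ ⋃ c, S c) {r : ℝ} (hr0 : 0 < r) (hr1 : r ≤ 1)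
    (hr : Fintype.card ι * r ^ (n + 1) ≤ 1) (w : EuclideanSpace ℝ (Fin (n + 1))) :
    ∃ c, (S c).Nonempty ∧
      r * (volume : Measure (EuclideanSpace ℝ (Fin (n + 1)))).toSphere.real univ ≤
        ∫ v : Metric.sphere (0 : EuclideanSpace ℝ (Fin (n + 1))) 1, supportFn (S c) (w + v)
          ∂(volume : Measure (EuclideanSpace ℝ (Fin (n + 1)))).toSphere := by
  set σ := (volume : Measure (EuclideanSpace ℝ (Fin (n + 1)))).toSphere with hσ
  rcases le_or_gt r ‖w‖ with hw | hw
  · have hw0 : ‖w‖ ≠ 0 := (hr0.trans_le hw).ne'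
    have hx1 : ‖‖w‖⁻¹ • w‖ = 1 := by rw [norm_smul, norm_inv, norm_norm, inv_mul_cancel₀ hw0]
    obtain ⟨c, hc⟩ := mem_iUnion.1 (hcov (by simpa using hx1.le))
    refine ⟨c, ⟨_, hc⟩, ?_⟩
    have hint : ∀ f : Metric.sphere (0 : EuclideanSpace ℝ (Fin (n + 1))) 1 → ℝ, Continuous f →
        Integrable f σ := fun f hf =>
      hf.integrable_of_hasCompactSupport (HasCompactSupport.of_compactSpace f)
    have hwx : inner ℝ (‖w‖⁻¹ • w) w = ‖w‖ := by
      rw [real_inner_smul_left, real_inner_self_eq_norm_sq]; field_simp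
    calc r * σ.real univ ≤ ‖w‖ * σ.real univ := by gcongr
      _ = ∫ v : Metric.sphere (0 : EuclideanSpace ℝ (Fin (n + 1))) 1,
            inner ℝ (‖w‖⁻¹ • w) (w + v) ∂σ := by
          simp only [inner_add_right]
          rw [integral_add (integrable_const _) (hint _ (by fun_prop)), integral_inner_toSphere,
            hwx, integral_const, smul_eq_mul]
          ring
      _ ≤ _ := by
          refine integral_mono (hint _ (by fun_prop))
            (hint _ ((continuous_supportFn (hS c) ⟨_, hc⟩).comp (by fun_prop))) fun v => ?_
          exact inner_le_supportFn (hS c) hc _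
  · set X := Metric.closedBall (0 : EuclideanSpace ℝ (Fin (n + 1))) 1 with hX
    set I := ∫⁻ x in X, ENNReal.ofReal (1 / (1 + inner ℝ w x)) with hI
    set J := ∫⁻ x in X, ENNReal.ofReal (1 / (r - inner ℝ w x) ^ (n + 1)) with hJ
    have hinner : ∀ x ∈ X, |inner ℝ w x| < r := fun x hx => by
      have h1 : ‖x‖ ≤ 1 := by simpa [hX] using hx
      calc |inner ℝ w x| ≤ ‖w‖ * ‖x‖ := abs_real_inner_le_norm _ _
        _ ≤ ‖w‖ * 1 := by gcongr
        _ < r := by linarith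
    have hIneg : I = ∫⁻ x in X, ENNReal.ofReal (1 / (1 - inner ℝ w x)) := by
      rw [hI, ← setLIntegral_closedBall_neg]
      simp [hX, sub_eq_add_neg]
    have hJneg : J = ∫⁻ x in X, ENNReal.ofReal (1 / (r + inner ℝ w x) ^ (n + 1)) := by
      rw [hJ, ← setLIntegral_closedBall_neg]
      simp [hX]
    have hIJ : (Fintype.card ι : ENNReal) * I ≤ J := by
      have h2 : (Fintype.card ι : ENNReal) * (I + I) ≤ J + J := by
        -- Averaging over `x` and `-x` makes a pointwise comparison of the integrands possible.
        nth_rewrite 2 [hIneg]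
        nth_rewrite 2 [hJneg]
        rw [hI, hJ, ← lintegral_add_left (by fun_prop), ← lintegral_add_left (by fun_prop),
          ← lintegral_const_mul _ (by fun_prop)]
        refine setLIntegral_mono' measurableSet_closedBall fun x hx => ?_
        obtain ⟨h3, h4⟩ := abs_lt.1 (hinner x hx)
        have h5 : 0 < r - inner ℝ w x := by linarith
        have h6 : 0 < r + inner ℝ w x := by linarith
        have h7 : 0 < 1 - inner ℝ w x := by linarith
        have h8 : 0 < 1 + inner ℝ w x := by linarith
        rw [← ENNReal.ofReal_add (by positivity) (by positivity),
          ← ENNReal.ofReal_add (by positivity) (by positivity), ← ENNReal.ofReal_natCast,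
          ← ENNReal.ofReal_mul (by positivity)]
        exact ENNReal.ofReal_le_ofReal
          (card_mul_le_inv_pow_add (by omega) (hinner x hx) hr1 hr)
      rw [← two_mul, ← two_mul, mul_left_comm] at h2
      exact (ENNReal.mul_le_mul_iff_right two_ne_zero ENNReal.ofNat_ne_top).1 h2
    have hex : ∃ c, I ≤ ∫⁻ y in closure (convexHull ℝ (S c)),
        ENNReal.ofReal (1 / (r - inner ℝ w y) ^ (n + 1)) := by
      by_contra! hcon
      have hne : (Finset.univ : Finset ι).Nonempty := by
        obtain ⟨c, -⟩ := mem_iUnion.1 (hcov (Metric.mem_closedBall_self zero_le_one))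
        exact ⟨c, Finset.mem_univ c⟩
      have h1 : J ≤ ∑ c, ∫⁻ y in closure (convexHull ℝ (S c)),
          ENNReal.ofReal (1 / (r - inner ℝ w y) ^ (n + 1)) := by
        have hsub : X ⊆ ⋃ c, closure (convexHull ℝ (S c)) :=
          hcov.trans (iUnion_mono fun c => (subset_convexHull ℝ _).trans subset_closure)
        have h := (lintegral_mono_set (μ := volume)
          (f := fun y => ENNReal.ofReal (1 / (r - inner ℝ w y) ^ (n + 1))) hsub).trans
          (lintegral_iUnion_le _ _)
        rw [tsum_fintype] at h
        exact h
      have h2 := ENNReal.sum_lt_sum_of_nonempty hne fun c _ => hcon c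
      rw [Finset.sum_const, nsmul_eq_mul, Finset.card_univ] at h2
      exact absurd (h1.trans_lt h2) (not_lt.2 hIJ)
    obtain ⟨c, hc⟩ := hex
    exact ⟨c, le_integral_supportFn (hS c) hw hr1 hc⟩

end BrunnMinkowski

/-! ### The adversary. -/

namespace GradObliviousAlg

variable {V : Type*} {d k : ℕ}

/-- Gradients in the same code cell are indistinguishable to the learner. This lets the adversary
replace them in hindsight. -/
lemma play_congr (A : GradObliviousAlg V d k) (N : SimpleGraph V) (I : ℕ → V)
    {g g' : ℕ → EuclideanSpace ℝ (Fin d)} {t : ℕ}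
    (h : ∀ s < t, A.encode (g s) = A.encode (g' s)) : A.play N I g t = A.play N I g' t := by
  unfold play
  congr 1
  funext s
  by_cases hs : Available N I s t (I t)
  · simp only [if_pos hs, h s hs.1]
  · simp only [if_neg hs]

/-- The adversary can answer every prediction by a gradient of its choice. -/
lemma exists_forall_play (A : GradObliviousAlg V d k) (N : SimpleGraph V) (I : ℕ → V)
    {P : EuclideanSpace ℝ (Fin d) → EuclideanSpace ℝ (Fin d) → Prop} (hP : ∀ w, ∃ x, P w x)
    (T : ℕ) : ∃ g : ℕ → EuclideanSpace ℝ (Fin d), ∀ t < T, P (A.play N I g t) (g t) := by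
  induction T with
  | zero => exact ⟨0, by simp⟩
  | succ T ih =>
    obtain ⟨g, hg⟩ := ih
    obtain ⟨x, hx⟩ := hP (A.play N I g T)
    have hplay : ∀ t ≤ T, A.play N I (Function.update g T x) t = A.play N I g t := fun t ht =>
      A.play_congr N I fun s hs => by rw [Function.update_of_ne (by omega)]
    refine ⟨Function.update g T x, fun t ht => ?_⟩
    rw [hplay t (by omega)]
    rcases (Nat.lt_succ_iff.1 ht).lt_or_eq with h | rfl
    · rw [Function.update_of_ne h.ne]; exact hg t h
    · simpa using hx

/-- The regret on linear losses bounds the supremum of the regret from below. -/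
lemma sum_inner_le_supRegret (A : GradObliviousAlg V d k) (N : SimpleGraph V) (I : ℕ → V)
    {G : ℝ≥0} {T : ℕ} {g : ℕ → EuclideanSpace ℝ (Fin d)} (hg : ∀ t < T, ‖g t‖ ≤ G)
    (u : EuclideanSpace ℝ (Fin d)) :
    ((∑ t ∈ Finset.range T, inner ℝ (g t) (A.play N I g t - u) : ℝ) : EReal) ≤
      A.supRegret N I G T u := by
  have hadm : A.IsAdmissible N I G T (fun t x => inner ℝ (g t) x) g := by
    intro t ht
    refine ⟨?_, ?_, fun x => ?_⟩
    · exact (innerSL ℝ (g t)).toLinearMap.convexOn convex_univ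
    · refine LipschitzWith.of_dist_le_mul fun x y => ?_
      rw [Real.dist_eq, ← inner_sub_right, dist_eq_norm]
      exact (abs_real_inner_le_norm _ _).trans (by gcongr; exact hg t ht)
    · rw [inner_sub_right]; linarith
  have hreg : A.regret N I T (fun t x => inner ℝ (g t) x) g u =
      ∑ t ∈ Finset.range T, inner ℝ (g t) (A.play N I g t - u) := by
    simp [regret, inner_sub_right]
  rw [← hreg]
  exact le_iSup_of_le _ (le_iSup_of_le g (le_iSup_of_le hadm le_rfl))

lemma zero_le_supRegret (A : GradObliviousAlg V d k) (N : SimpleGraph V) (I : ℕ → V)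
    (G : ℝ≥0) (T : ℕ) (u : EuclideanSpace ℝ (Fin d)) : 0 ≤ A.supRegret N I G T u := by
  simpa using A.sum_inner_le_supRegret N I (G := G) (T := T) (g := 0) (by simp) u

open MeasureTheory in
/-- A `k`-bit encoding forces linear regret: some code cell is too large. -/
theorem exists_linear_le_supRegret {n : ℕ} (A : GradObliviousAlg V (n + 1) k) (N : SimpleGraph V)
    (I : ℕ → V) {G : ℝ≥0} (hG : 0 < G) {U : ℝ} (hU : 0 < U) {r : ℝ} (hr0 : 0 < r) (hr1 : r ≤ 1)
    (hr : 2 ^ k * r ^ (n + 1) ≤ 1) (T : ℕ) :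
    ∃ u : EuclideanSpace ℝ (Fin (n + 1)), ‖u‖ = U ∧
      ((T * r * U * G : ℝ) : EReal) ≤ A.supRegret N I G T u := by
  set σ := (volume : Measure (EuclideanSpace ℝ (Fin (n + 1)))).toSphere with hσ
  set S : (Fin k → Bool) → Set (EuclideanSpace ℝ (Fin (n + 1))) :=
    fun c => {x | x ∈ Metric.closedBall 0 1 ∧ A.encode ((G : ℝ) • x) = c} with hSdef
  have hS : ∀ c, S c ⊆ Metric.closedBall 0 1 := fun c x hx => hx.1
  have hGR : (0 : ℝ) < G := hG
  have hcell := exists_cell_le_integral_supportFn hS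
    (fun x hx => Set.mem_iUnion.2 ⟨A.encode ((G : ℝ) • x), hx, rfl⟩) hr0 hr1 (by simpa using hr)
  -- The condition concerns `x` only through its cell: `g` merely represents the sequence of cells
  -- and is not yet the final sequence of gradients.
  obtain ⟨g, hg⟩ := A.exists_forall_play N I (P := fun w x => (S (A.encode x)).Nonempty ∧
      r * σ.real Set.univ ≤ ∫ v : Metric.sphere (0 : EuclideanSpace ℝ (Fin (n + 1))) 1,
        supportFn (S (A.encode x)) (U⁻¹ • w + v) ∂σ) (fun w => by
    obtain ⟨c, ⟨x, hx⟩, hc⟩ := hcell (U⁻¹ • w)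
    refine ⟨(G : ℝ) • x, ?_⟩
    rw [hx.2]
    exact ⟨⟨x, hx⟩, hc⟩) T
  set W : ℕ → EuclideanSpace ℝ (Fin (n + 1)) := fun t => A.play N I g t with hW
  have hint : ∀ t ∈ Finset.range T,
      Integrable (fun v : Metric.sphere (0 : EuclideanSpace ℝ (Fin (n + 1))) 1 =>
        supportFn (S (A.encode (g t))) (U⁻¹ • W t + v)) σ := fun t ht => by
    have hc := (continuous_supportFn (hS (A.encode (g t))) (hg t (Finset.mem_range.1 ht)).1).comp
      (show Continuous fun v : Metric.sphere (0 : EuclideanSpace ℝ (Fin (n + 1))) 1 =>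
        U⁻¹ • W t + (v : EuclideanSpace ℝ (Fin (n + 1))) by fun_prop)
    exact hc.integrable_of_hasCompactSupport (HasCompactSupport.of_compactSpace _)
  obtain ⟨v, hv⟩ : ∃ v : Metric.sphere (0 : EuclideanSpace ℝ (Fin (n + 1))) 1,
      T * r ≤ ∑ t ∈ Finset.range T, supportFn (S (A.encode (g t))) (U⁻¹ • W t + v) := by
    have hσ0 : σ ≠ 0 := Measure.toSphere_ne_zero _
    have hσpos : 0 < σ.real Set.univ :=
      haveI : NeZero σ := ⟨hσ0⟩
      measureReal_univ_pos
    obtain ⟨v, hv⟩ := exists_average_le hσ0 (integrable_finsetSum (Finset.range T) hint)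
    refine ⟨v, le_trans ?_ hv⟩
    rw [average_eq, integral_finsetSum _ hint, smul_eq_mul, inv_mul_eq_div, le_div_iff₀ hσpos]
    calc T * r * σ.real Set.univ = ∑ t ∈ Finset.range T, r * σ.real Set.univ := by
          simp; ring
      _ ≤ _ := Finset.sum_le_sum fun t ht => (hg t (Finset.mem_range.1 ht)).2
  refine ⟨-(U • (v : EuclideanSpace ℝ (Fin (n + 1)))), by simp [norm_smul, abs_of_pos hU], ?_⟩
  -- The cells are arbitrary sets, so their support functions need not be attained. The bound is
  -- proved up to an arbitrary loss, shared over the rounds by `ε`; the `T + 1` in `ε` covers `T =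
  -- 0`.
  refine EReal.ge_of_forall_gt_iff_ge.1 fun z hz => ?_
  have hz' : z < T * r * U * G := by exact_mod_cast hz
  set ε : ℝ := (T * r * U * G - z) / (U * G * (T + 1)) with hε
  have hε0 : 0 < ε := div_pos (by linarith) (by positivity)
  have hx : ∀ t, ∃ x : EuclideanSpace ℝ (Fin (n + 1)), t < T → x ∈ S (A.encode (g t)) ∧
      supportFn (S (A.encode (g t))) (U⁻¹ • W t + v) - ε ≤
        inner ℝ x (U⁻¹ • W t + (v : EuclideanSpace ℝ (Fin (n + 1)))) := by
    intro t
    by_cases ht : t < T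
    · obtain ⟨_, ⟨x, hx, rfl⟩, hlt⟩ := exists_lt_of_lt_csSup ((hg t ht).1.image _)
        (show supportFn (S (A.encode (g t))) (U⁻¹ • W t + v) - ε <
          supportFn (S (A.encode (g t))) (U⁻¹ • W t + v) by linarith)
      exact ⟨x, fun _ => ⟨hx, hlt.le⟩⟩
    · exact ⟨0, fun h => absurd h ht⟩
  choose x hx using hx
  -- The gradients `G x_t` adapted to `v` lie in the cells fixed before, hence the predictions do
  -- not change.
  have hplay : ∀ t < T, A.play N I (fun t => (G : ℝ) • x t) t = W t := fun t ht =>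
    A.play_congr N I fun s hs => (hx s (hs.trans ht)).1.2
  refine le_trans ?_ (A.sum_inner_le_supRegret N I (g := fun t => (G : ℝ) • x t) (fun t ht => ?_) _)
  · rw [EReal.coe_le_coe_iff]
    have hterm : ∀ t ∈ Finset.range T,
        G * U * (supportFn (S (A.encode (g t))) (U⁻¹ • W t + v) - ε) ≤
          inner ℝ ((G : ℝ) • x t) (A.play N I (fun t => (G : ℝ) • x t) t -
            -(U • (v : EuclideanSpace ℝ (Fin (n + 1))))) := fun t ht => by
      have ht' := Finset.mem_range.1 ht
      have e : W t - -(U • (v : EuclideanSpace ℝ (Fin (n + 1)))) =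
          U • (U⁻¹ • W t + (v : EuclideanSpace ℝ (Fin (n + 1)))) := by
        rw [smul_add, smul_inv_smul₀ hU.ne', sub_neg_eq_add]
      rw [hplay t ht', e, real_inner_smul_left, real_inner_smul_right, ← mul_assoc]
      exact mul_le_mul_of_nonneg_left (hx t ht').2 (by positivity)
    refine le_trans ?_ (Finset.sum_le_sum hterm)
    rw [← Finset.mul_sum, Finset.sum_sub_distrib, Finset.sum_const, Finset.card_range, nsmul_eq_mul]
    have h1 : U * G * (T * ε) ≤ T * r * U * G - z := by
      have : U * G * ((T + 1) * ε) = T * r * U * G - z := by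
        rw [hε]; field_simp
      nlinarith [mul_pos (mul_pos hU hGR) hε0]
    have h2 := mul_le_mul_of_nonneg_left hv (mul_nonneg hGR.le hU.le)
    rw [mul_sub]
    nlinarith
  · have h1 : ‖x t‖ ≤ 1 := by simpa using (hx t ht).1.1
    rw [norm_smul]
    simp only [NNReal.norm_eq]
    nlinarith [G.2]

end GradObliviousAlg

/-! ### Comparison of the two entries, and the theorem. -/

/-- A logarithmic term is eventually dominated by a linear one. -/
lemma exists_forall_sqrt_mul_log_le {D c δ : ℝ} (hD : 0 ≤ D) (hc : 0 ≤ c) (hδ : 0 < δ) :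
    ∃ T₀ : ℕ, ∀ T : ℕ, T₀ ≤ T → √(D * T * Real.log (c * T)) ≤ T * δ := by
  refine ⟨⌈(2 * D * √c / δ ^ 2) ^ 2⌉₊, fun T hT => ?_⟩
  have hT' : (2 * D * √c / δ ^ 2) ^ 2 ≤ T := (Nat.le_ceil _).trans (by exact_mod_cast hT)
  have hsq : 2 * D * √c / δ ^ 2 ≤ √T := Real.le_sqrt_of_sq_le hT'
  rw [div_le_iff₀ (by positivity)] at hsq
  have hcT : 0 ≤ c * T := by positivity
  have hlog : Real.log (c * T) ≤ 2 * (√c * √T) := by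
    rcases hcT.eq_or_lt with h | h
    · rw [← h, Real.log_zero]; positivity
    · have h1 := Real.log_le_sub_one_of_pos (Real.sqrt_pos.2 h)
      rw [Real.log_sqrt hcT, Real.sqrt_mul hc] at h1
      linarith
  refine Real.sqrt_le_iff.2 ⟨by positivity, ?_⟩
  have hTT : √(T : ℝ) * √T = T := Real.mul_self_sqrt (by positivity)
  calc D * T * Real.log (c * T) ≤ D * T * (2 * (√c * √T)) := by gcongr
    _ = T * ((2 * D * √c) * √T) := by ring
    _ ≤ T * ((√T * δ ^ 2) * √T) := by gcongr
    _ = T * (√T * √T) * δ ^ 2 := by ring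
    _ = (T * δ) ^ 2 := by rw [hTT]; ring

lemma two_pow_div_mul_rpow_le_one (b D n : ℕ) :
    2 ^ (b / D) * ((2 : ℝ) ^ (-((b : ℝ) / (((n + 1 : ℕ) : ℝ) * D)))) ^ (n + 1) ≤ 1 := by
  rw [← Real.rpow_natCast (_ ^ _), ← Real.rpow_mul zero_le_two, ← Real.rpow_natCast,
    ← Real.rpow_add two_pos]
  refine Real.rpow_le_one_of_one_le_of_nonpos one_le_two ?_
  have h : ((b / D : ℕ) : ℝ) ≤ (b : ℝ) / D := Nat.cast_div_le
  have e : -((b : ℝ) / (((n + 1 : ℕ) : ℝ) * D)) * ((n + 1 : ℕ) : ℝ) = -((b : ℝ) / D) := by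
    have : ((n + 1 : ℕ) : ℝ) ≠ 0 := by positivity
    rcases eq_or_ne (D : ℝ) 0 with h0 | h0
    · simp [h0]
    · field_simp
  rw [e]
  linarith

theorem mainTheorem6 {V : Type*} [Finite V] [Nontrivial V] (N : SimpleGraph V)
    (hN : N.Connected) (d : ℕ) (hd : 1 ≤ d) (b : ℕ) (G : ℝ≥0) :
    ∃ I : ℕ → V, ∀ ν : ℝ, 0 < ν →
      -- `A T` is the algorithm that is run when the horizon is `T`
      ∀ A : ℕ → GradObliviousAlg V d (b / N.diam),
        (∀ T : ℕ, (A T).supRegret N I G T 0 ≤ (ν : EReal)) →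
        ∀ U : ℝ, 0 ≤ U → ∃ T₀ : ℕ, ∀ T ≥ T₀, ∃ u : EuclideanSpace ℝ (Fin d), ‖u‖ = U ∧
          ((max
              (0.15 * ‖u‖ * G *
                √(N.diam * T * Real.log (‖u‖ ^ 2 * T / (72 * ν ^ 2 * N.diam))))
              (T * (2 : ℝ) ^ (-((b : ℝ) / (d * N.diam))) * ‖u‖ * G) : ℝ) : EReal)
            ≤ (A T).supRegret N I G T u := by
  -- The bound comes from the size of the code alone, so any constant activation sequence serves.
  obtain ⟨v₀⟩ : Nonempty V := inferInstance
  refine ⟨fun _ => v₀, fun ν hν A _ U hU => ?_⟩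
  obtain ⟨n, rfl⟩ : ∃ n, d = n + 1 := ⟨d - 1, by omega⟩
  set δ : ℝ := (2 : ℝ) ^ (-((b : ℝ) / (((n + 1 : ℕ) : ℝ) * N.diam))) with hδ
  have hδ0 : 0 < δ := Real.rpow_pos_of_pos two_pos _
  have hδ1 : δ ≤ 1 :=
    Real.rpow_le_one_of_one_le_of_nonpos one_le_two (neg_nonpos.2 (by positivity))
  rcases hU.eq_or_lt with rfl | hU
  · refine ⟨0, fun T _ => ⟨0, norm_zero, ?_⟩⟩
    simpa using (A T).zero_le_supRegret N _ G T 0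
  rcases eq_or_ne G 0 with rfl | hG
  · refine ⟨0, fun T _ => ⟨EuclideanSpace.single 0 U, by simp [abs_of_pos hU], ?_⟩⟩
    simpa using (A T).zero_le_supRegret N _ 0 T _
  obtain ⟨T₀, hT₀⟩ := exists_forall_sqrt_mul_log_le (D := N.diam)
    (c := U ^ 2 / (72 * ν ^ 2 * N.diam)) (by positivity) (by positivity) hδ0
  refine ⟨T₀, fun T hT => ?_⟩
  obtain ⟨u, hu, hle⟩ := (A T).exists_linear_le_supRegret N (fun _ => v₀) (pos_iff_ne_zero.2 hG)
    hU hδ0 hδ1 (two_pow_div_mul_rpow_le_one b N.diam n) T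
  refine ⟨u, hu, le_trans ?_ hle⟩
  rw [EReal.coe_le_coe_iff, hu]
  refine max_le ?_ le_rfl
  have h := hT₀ T hT
  rw [div_mul_eq_mul_div] at h
  calc 0.15 * U * G * √(N.diam * T * Real.log (U ^ 2 * T / (72 * ν ^ 2 * N.diam)))
      ≤ 0.15 * U * G * (T * δ) := by gcongr
    _ ≤ 1 * U * G * (T * δ) := by gcongr; norm_num
    _ = T * δ * U * G := by ring
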